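/- Let $Q$ be a smooth manifold (Hausdorff, second countable, of finite dimension), $\mu$ a measure on $Q$ with smooth positive density in charts, and $E\to Q$ a smooth complex line bundle with a smooth Hermitian metric. Write $L^2(Q,E)$ for the Hilbert space of square-integrable sections and $\Gamma_c^\infty(Q,E)$ for the smooth compactly supported sections. Let $\mathcal A=C_0^\infty(Q)$ be the algebra of smooth real-valued functions on $Q$ vanishing at infinity (or, more generally, any real subalgebra with $C_c^\infty(Q)\subseteq\mathcal A\subseteq C_0^\infty(Q)$). A *scalar quantum mechanics* over $Q$ is a complex Hilbert space $H$ with a family $(\mathcal A_t)_{t\in\mathbb R}$ of representations $a\mapsto a_t\in B(H)$ of $\mathcal A$, $\mathcal A_t=\{a_t: a\in\mathcal A\}$, such that: * (Localizability) For every $t$ there is a given unitary $L_t:L^2(Q,E)\to H$ with $a_tL_t\sigma=L_t(a\sigma)$ for all $a\in\mathcal A$ and $\sigma\in L^2(Q,E)$. Put $H_{\infty,t}=L_t\,\Gamma_c^\infty(Q,E)$, the space of smooth compactly supported sections in the representation at time $t$. * (Smoothness) For $\psi\in H_{\infty,t}$ and $a\in\mathcal A$ the map $\tau\mapsto a_\tau\psi$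 is $C^\infty$, and its derivative at $\tau=t$, denoted $\dot a_t\psi$, lies in $H_{\infty,t}$. (So $\dot a_t$ is an operator on $H_{\infty,t}$, in general unbounded.) Moreover, for all $t$ and all $a,b\in\mathcal A$ there is $c\in\mathcal A$ with $i[a_t,\dot b_t]=c_t$ on $H_{\infty,t}$. * (Nontriviality and positivity) For all $t$ and $a\in\mathcal A$, $-i[a_t,\dot a_t]\ge 0$ on $H_{\infty,t}$; and if $[a_t,\dot a_t]=0$ on $H_{\infty,t}$ then $\dot a_t=0$ on $H_{\infty,t}$. Let $(H,\mathcal A_t)$ be a scalar quantum mechanics over $Q$. Then: 1. For every $t$, the closure of $\mathcal A_t$ in the strong operator topology is the self-adjoint (real) part of its commutant: $$\overline{\mathcal A_t}=\{T\in\mathcal A_t' : T=T^*\},$$ and the strong closure of the set of positive operators in $\mathcal A_t$ is the set of positive operators in $\mathcal A_t'$. 2. There is a family $(H(t))_{t\in\mathbb R}$ of formally self-adjoint (generally unbounded) operators, $H(t)$ having the dense domain $H_{\infty,t}$ (which is mapped into itself by every $a_t$), such that $$\dot a_t=i\,[a_t,H(t)]\quad\text{on }H_{\infty,t}\qquad\text{for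 all }t\in\mathbb R,\ a\in\mathcal A.$$ In particular, if the spaces $H_{\infty,t}$ do not depend on $t$, all $H(t)$ have one common dense domain $H_\infty$. -/

import Mathlib

open MeasureTheory Bundle Set Filter Topology
open scoped Manifold ContDiff ENNReal

/-- `C₀^∞(Q)`: the real algebra of smooth real-valued functions on `Q` that vanish at infinity. -/
def smoothZeroAtInfty (n : ℕ) (Q : Type*) [TopologicalSpace Q]
    [ChartedSpace (EuclideanSpace ℝ (Fin n)) Q] : NonUnitalSubalgebra ℝ (Q → ℝ) where
  carrier := {f | ContMDiff (𝓡 n) 𝓘(ℝ, ℝ) ∞ f ∧ Tendsto f (cocompact Q) (𝓝 0)}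
  add_mem' := fun {_ _} hf hg => ⟨hf.1.add hg.1, by
    have h := hf.2.add hg.2
    rw [add_zero] at h
    exact h⟩
  zero_mem' := ⟨contMDiff_const, tendsto_const_nhds⟩
  mul_mem' := fun {_ _} hf hg => ⟨hf.1.mul hg.1, by
    have h := hf.2.mul hg.2
    rw [mul_zero] at h
    exact h⟩
  smul_mem' := fun c _ hf => ⟨(contMDiff_const (c := c)).mul hf.1, by
    have h := hf.2.const_smul c
    rw [smul_zero] at h
    exact h⟩

theorem smoothZeroAtInfty_bounded {n : ℕ} {Q : Type*} [TopologicalSpace Q]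
    [ChartedSpace (EuclideanSpace ℝ (Fin n)) Q] {f : Q → ℝ} (hf : f ∈ smoothZeroAtInfty n Q) :
    ∃ C, ∀ x, |f x| ≤ C := by
  have hc : ContMDiff (𝓡 n) 𝓘(ℝ, ℝ) ∞ f ∧ Tendsto f (cocompact Q) (𝓝 0) := hf
  let F : ZeroAtInftyContinuousMap Q ℝ := ⟨⟨f, hc.1.continuous⟩, hc.2⟩
  obtain ⟨C, hC⟩ := ZeroAtInftyContinuousMap.bounded F
  rcases isEmpty_or_nonempty Q with hQ | ⟨⟨x₀⟩⟩
  · exact ⟨0, fun x => (hQ.false x).elim⟩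
  · refine ⟨C + |f x₀|, fun x => ?_⟩
    have h1 : |f x - f x₀| ≤ C := hC x x₀
    have h2 := abs_sub_abs_le_abs_sub (f x) (f x₀)
    linarith

/-- A measure on a manifold given in every preferred chart by a smooth, strictly positive density
with respect to Lebesgue measure. -/
def IsSmoothDensity (n : ℕ) {Q : Type*} [TopologicalSpace Q]
    [ChartedSpace (EuclideanSpace ℝ (Fin n)) Q] [MeasurableSpace Q] (μ : Measure Q) : Prop :=
  ∀ x₀ : Q, ∃ ρ : EuclideanSpace ℝ (Fin n) → ℝ,
    ContDiffOn ℝ ∞ ρ (chartAt (EuclideanSpace ℝ (Fin n)) x₀).target ∧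
    (∀ y ∈ (chartAt (EuclideanSpace ℝ (Fin n)) x₀).target, 0 < ρ y) ∧
    ∀ B : Set Q, MeasurableSet B → B ⊆ (chartAt (EuclideanSpace ℝ (Fin n)) x₀).source →
      μ B = ∫⁻ y in chartAt (EuclideanSpace ℝ (Fin n)) x₀ '' B, ENNReal.ofReal (ρ y)

section LineBundle

variable (n : ℕ) {Q : Type*} [TopologicalSpace Q] [ChartedSpace (EuclideanSpace ℝ (Fin n)) Q]
  (E : Q → Type*) [∀ x, NormedAddCommGroup (E x)] [∀ x, InnerProductSpace ℂ (E x)]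
  [TopologicalSpace (TotalSpace ℂ E)] [FiberBundle ℂ E] [VectorBundle ℂ ℂ E]

/-- The Hermitian inner products on the fibres of a complex line bundle vary smoothly with the base
point: the squared length of each local frame `x ↦ e.symm x 1` is smooth. (Fibres are complex
lines, so this is smoothness of the metric.) -/
def IsSmoothHermitian : Prop :=
  ∀ x₀ : Q, ContMDiffOn (𝓡 n) 𝓘(ℝ, ℝ) ∞
    (fun x => ‖(trivializationAt ℂ E x₀).symm x (1 : ℂ)‖ ^ 2) (trivializationAt ℂ E x₀).baseSet

variable {E}

/-- A (not necessarily continuous) section is Borel measurable if it is so in local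
trivializations. -/
def IsMeasurableSection [MeasurableSpace Q] (σ : ∀ x, E x) : Prop :=
  ∀ x₀ : Q, Measurable fun x : (trivializationAt ℂ E x₀).baseSet =>
    (trivializationAt ℂ E x₀ ⟨x, σ x⟩).2

/-- Smooth sections with compact support. -/
def IsSmoothCompactSection (σ : ∀ x, E x) : Prop :=
  ContMDiff (𝓡 n) ((𝓡 n).prod 𝓘(ℝ, ℂ)) ∞ (fun x => TotalSpace.mk' ℂ x (σ x)) ∧
  ∃ K : Set Q, IsCompact K ∧ ∀ x ∉ K, σ x = 0

variable {n}

theorem IsMeasurableSection.norm [MeasurableSpace Q] [BorelSpace Q] [SecondCountableTopology Q]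
    (hE : IsSmoothHermitian n E) {σ : ∀ x, E x} (hσ : IsMeasurableSection σ) :
    Measurable fun x => ‖σ x‖ := by
  obtain ⟨S, hS, hcov⟩ := TopologicalSpace.countable_cover_nhds
    (f := fun x₀ : Q => (trivializationAt ℂ E x₀).baseSet)
    (fun x₀ => (trivializationAt ℂ E x₀).open_baseSet.mem_nhds
      (FiberBundle.mem_baseSet_trivializationAt ℂ E x₀))
  have key : ∀ x₀ : Q, Measurable fun x : (trivializationAt ℂ E x₀).baseSet => ‖σ x‖ := by
    intro x₀
    have h1 : ContinuousOn (fun x => ‖(trivializationAt ℂ E x₀).symm x (1 : ℂ)‖)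
        (trivializationAt ℂ E x₀).baseSet := by
      have := (hE x₀).continuousOn.sqrt
      simpa [Real.sqrt_sq (norm_nonneg _)] using this
    have h2 := (hσ x₀).norm.mul (continuousOn_iff_continuous_domRestrict.1 h1).measurable
    convert h2 using 2 with x
    have e1 : (trivializationAt ℂ E x₀).symm x (trivializationAt ℂ E x₀ ⟨x, σ x⟩).2 = σ x :=
      (trivializationAt ℂ E x₀).symm_apply_apply_mk x.2 (σ x)
    have e2 := ((trivializationAt ℂ E x₀).symmₗ ℂ x).map_smul
      (trivializationAt ℂ E x₀ ⟨x, σ x⟩).2 1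
    rw [smul_eq_mul, mul_one, Trivialization.coe_symmₗ _ x.2] at e2
    have e3 : σ x = (trivializationAt ℂ E x₀ ⟨x, σ x⟩).2 • (trivializationAt ℂ E x₀).symm x 1 :=
      e1.symm.trans e2
    change ‖σ x‖ = ‖(trivializationAt ℂ E x₀ ⟨x, σ x⟩).2‖ * ‖(trivializationAt ℂ E x₀).symm x 1‖
    rw [← norm_smul, ← e3]
  intro s hs
  have : (fun x => ‖σ x‖) ⁻¹' s = ⋃ x₀ ∈ S, (Subtype.val ''
      ((fun x : (trivializationAt ℂ E x₀).baseSet => ‖σ x‖) ⁻¹' s)) := by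
    ext x
    have hx : x ∈ ⋃ x₀ ∈ S, (trivializationAt ℂ E x₀).baseSet := by rw [hcov]; trivial
    simp only [mem_iUnion, exists_prop] at hx
    simp only [mem_preimage, mem_iUnion, mem_image, Subtype.exists, exists_and_right,
      exists_eq_right, exists_prop]
    constructor
    · intro h
      obtain ⟨x₀, h1, h2⟩ := hx
      exact ⟨x₀, h1, h2, h⟩
    · rintro ⟨_, _, _, h⟩
      exact h
  rw [this]
  exact MeasurableSet.biUnion hS fun x₀ _ =>
    (trivializationAt ℂ E x₀).open_baseSet.measurableSet.subtype_image (key x₀ hs)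

/-- `𝓛²(Q, E)`: Borel sections with square-integrable norm. The Hilbert space `L²(Q, E)` is its
quotient by the sections that vanish almost everywhere. -/
def squareIntegrable [MeasurableSpace Q] [BorelSpace Q] [SecondCountableTopology Q]
    (hE : IsSmoothHermitian n E) (μ : Measure Q) : Submodule ℂ (∀ x, E x) where
  carrier := {σ | IsMeasurableSection σ ∧ MemLp (fun x => ‖σ x‖) 2 μ}
  add_mem' := fun {σ τ} hσ hτ => by
    have hm : IsMeasurableSection (σ + τ) := fun x₀ => by
      convert (hσ.1 x₀).add (hτ.1 x₀) using 2 with x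
      exact ((trivializationAt ℂ E x₀).linear ℂ x.2).map_add _ _
    refine ⟨hm, (hσ.2.add hτ.2).mono (hm.norm hE).aestronglyMeasurable (ae_of_all _ fun x => ?_)⟩
    simp only [norm_norm, Pi.add_apply]
    exact (norm_add_le _ _).trans (le_abs_self _)
  zero_mem' := by
    refine ⟨fun x₀ => ?_, by simp⟩
    have : (fun x : (trivializationAt ℂ E x₀).baseSet =>
        (trivializationAt ℂ E x₀ ⟨x, (0 : ∀ x, E x) x⟩).2) = fun _ => 0 := by
      ext1 x
      exact ((trivializationAt ℂ E x₀).linear ℂ x.2).map_zero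
    rw [this]
    exact measurable_const
  smul_mem' := fun c σ hσ => by
    refine ⟨fun x₀ => ?_, ?_⟩
    · convert (hσ.1 x₀).const_smul c using 2 with x
      exact ((trivializationAt ℂ E x₀).linear ℂ x.2).map_smul _ _
    · simpa [norm_smul] using hσ.2.const_mul ‖c‖

/-- Pointwise multiplication of a square-integrable section by a function in `C₀^∞(Q)`. -/
def mulSection [MeasurableSpace Q] [BorelSpace Q] [SecondCountableTopology Q]
    (hE : IsSmoothHermitian n E) (μ : Measure Q) (f : Q → ℝ) (hf : f ∈ smoothZeroAtInfty n Q)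
    (σ : squareIntegrable hE μ) : squareIntegrable hE μ :=
  ⟨fun x => (f x : ℂ) • (σ : ∀ x, E x) x, by
    have hc : Continuous f :=
      (show ContMDiff (𝓡 n) 𝓘(ℝ, ℝ) ∞ f ∧ Tendsto f (cocompact Q) (𝓝 0) from hf).1.continuous
    have hm : IsMeasurableSection fun x => (f x : ℂ) • (σ : ∀ x, E x) x := fun x₀ => by
      have hfm : Measurable fun x : (trivializationAt ℂ E x₀).baseSet => (f x : ℂ) :=
        (Complex.continuous_ofReal.comp (hc.comp continuous_subtype_val)).measurable
      convert hfm.smul (σ.2.1 x₀) using 2 with x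
      exact ((trivializationAt ℂ E x₀).linear ℂ x.2).map_smul _ _
    obtain ⟨C, hC⟩ := smoothZeroAtInfty_bounded hf
    refine ⟨hm, (σ.2.2.const_mul C).mono (hm.norm hE).aestronglyMeasurable
      (ae_of_all _ fun x => ?_)⟩
    rw [norm_norm, norm_smul, norm_mul, norm_norm, Complex.norm_real, Real.norm_eq_abs,
      Real.norm_eq_abs]
    exact mul_le_mul_of_nonneg_right ((hC x).trans (le_abs_self C)) (norm_nonneg _)⟩

end LineBundle

section ScalarQuantumMechanics

variable {n : ℕ} {Q : Type*} [TopologicalSpace Q]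
  [ChartedSpace (EuclideanSpace ℝ (Fin n)) Q] [SecondCountableTopology Q]
  [MeasurableSpace Q] [BorelSpace Q]
  {E : Q → Type*} [∀ x, NormedAddCommGroup (E x)] [∀ x, InnerProductSpace ℂ (E x)]
  [TopologicalSpace (TotalSpace ℂ E)] [FiberBundle ℂ E] [VectorBundle ℂ ℂ E]

/-- A family of representations `a ↦ a_t = rep t a` (`t ∈ ℝ`), on one Hilbert space `H`, of an
algebra `𝒜` of functions in `C₀^∞(Q)`, each of them unitarily equivalent to the representation by
multiplication operators on `L²(Q, E)` (localizability). The unitary `L²(Q, E) ≃ H` at time `t` is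
given as the linear map `loc t` it induces on square-integrable sections: `loc t` is onto `H` and
carries the `L²` inner product to that of `H` (so its kernel consists of the null sections). -/
structure LocalizableFamily (hE : IsSmoothHermitian n E) (μ : Measure Q)
    (𝒜 : NonUnitalSubalgebra ℝ (Q → ℝ)) (h𝒜 : 𝒜 ≤ smoothZeroAtInfty n Q)
    (H : Type*) [NormedAddCommGroup H] [InnerProductSpace ℂ H] where
  rep : ℝ → 𝒜 →ₙₐ[ℝ] (H →L[ℂ] H)
  loc : ℝ → squareIntegrable hE μ →ₗ[ℂ] H
  loc_surjective : ∀ t, Function.Surjective (loc t)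
  inner_loc : ∀ t σ τ, inner ℂ (loc t σ) (loc t τ) = ∫ x, inner ℂ (σ.1 x) (τ.1 x) ∂μ
  rep_loc : ∀ t (a : 𝒜) σ, rep t a (loc t σ) = loc t (mulSection hE μ a (h𝒜 a.2) σ)

namespace LocalizableFamily

variable {hE : IsSmoothHermitian n E} {μ : Measure Q} {𝒜 : NonUnitalSubalgebra ℝ (Q → ℝ)}
  {h𝒜 : 𝒜 ≤ smoothZeroAtInfty n Q} {H : Type*} [NormedAddCommGroup H] [InnerProductSpace ℂ H]

/-- The vectors that are smooth compactly supported sections of `E` in the representation at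
time `t`. -/
def smoothVectors (S : LocalizableFamily hE μ 𝒜 h𝒜 H) (t : ℝ) : Set H :=
  {ψ | ∃ σ, IsSmoothCompactSection n σ.1 ∧ S.loc t σ = ψ}

/-- The velocity `ȧ_t`, as a strong derivative: `vel t a ψ` is the derivative of `τ ↦ a_τ ψ`
at `t`. It is only used on vectors for which this map is differentiable. -/
noncomputable def vel (S : LocalizableFamily hE μ 𝒜 h𝒜 H) (t : ℝ) (a : 𝒜) (ψ : H) : H :=
  deriv (fun τ => S.rep τ a ψ) t

/-- `[a_t, ḃ_t] ψ`. -/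
noncomputable def comm (S : LocalizableFamily hE μ 𝒜 h𝒜 H) (t : ℝ) (a b : 𝒜) (ψ : H) : H :=
  S.rep t a (S.vel t b ψ) - S.vel t b (S.rep t a ψ)

end LocalizableFamily

/-- A scalar quantum mechanics over `Q`. The velocities are in general unbounded operators; at
time `t` they are taken on the smooth vectors of the representation at time `t`. -/
structure ScalarQM (hE : IsSmoothHermitian n E) (μ : Measure Q)
    (𝒜 : NonUnitalSubalgebra ℝ (Q → ℝ)) (h𝒜 : 𝒜 ≤ smoothZeroAtInfty n Q)
    (H : Type*) [NormedAddCommGroup H] [InnerProductSpace ℂ H]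
    extends LocalizableFamily hE μ 𝒜 h𝒜 H where
  /-- Smoothness of the time evolution in the strong sense. -/
  smooth : ∀ t, ∀ ψ ∈ toLocalizableFamily.smoothVectors t, ∀ a, ContDiff ℝ ∞ fun τ => rep τ a ψ
  /-- `ȧ_t` is an operator on the smooth vectors. -/
  vel_mem : ∀ t, ∀ ψ ∈ toLocalizableFamily.smoothVectors t, ∀ a,
    toLocalizableFamily.vel t a ψ ∈ toLocalizableFamily.smoothVectors t
  /-- `i[𝒜_t, 𝒜̇_t] ⊆ 𝒜_t`. -/
  uncertainty : ∀ t (a b : 𝒜), ∃ c : 𝒜, ∀ ψ ∈ toLocalizableFamily.smoothVectors t,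
    Complex.I • toLocalizableFamily.comm t a b ψ = rep t c ψ
  /-- `-i[a_t, ȧ_t] ≥ 0`. -/
  positivity : ∀ t (a : 𝒜), ∀ ψ ∈ toLocalizableFamily.smoothVectors t,
    0 ≤ (inner ℂ ψ (-Complex.I • toLocalizableFamily.comm t a a ψ)).re
  /-- `[a_t, ȧ_t] = 0` implies `ȧ_t = 0`. -/
  nontriviality : ∀ t (a : 𝒜),
    (∀ ψ ∈ toLocalizableFamily.smoothVectors t, toLocalizableFamily.comm t a a ψ = 0) →
      ∀ ψ ∈ toLocalizableFamily.smoothVectors t, toLocalizableFamily.vel t a ψ = 0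

end ScalarQuantumMechanics

/-- The closure of a set of bounded operators in the strong operator topology. -/
def strongClosure {H : Type*} [NormedAddCommGroup H] [InnerProductSpace ℂ H]
    (S : Set (H →L[ℂ] H)) : Set (H →L[ℂ] H) :=
  ContinuousLinearMap.toPointwiseConvergenceCLM ℂ (RingHom.id ℂ) H H ⁻¹'
    closure (ContinuousLinearMap.toPointwiseConvergenceCLM ℂ (RingHom.id ℂ) H H '' S)

section Calculus

universe u

theorem contDiff_natCast_integral_unitInterval {E F : Type u} [NormedAddCommGroup E]
    [NormedSpace ℝ E] [FiniteDimensional ℝ E] [NormedAddCommGroup F] [NormedSpace ℝ F]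
    (k : ℕ) {G : E × ℝ → F} (hG : ContDiff ℝ ∞ G) :
    ContDiff ℝ k fun y => ∫ s in (0 : ℝ)..1, G (y, s) := by
  have hprop : ProperSpace E := FiniteDimensional.proper ℝ E
  have key : ∀ {F : Type u} [NormedAddCommGroup F] [NormedSpace ℝ F] {G : E × ℝ → F},
      ContDiff ℝ ∞ G → ∀ y, HasFDerivAt (fun y => ∫ s in (0 : ℝ)..1, G (y, s))
        (∫ s in (0 : ℝ)..1, (fderiv ℝ G (y, s)).comp (ContinuousLinearMap.inl ℝ E ℝ)) y := by
    intro F _ _ G hG y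
    have hc : Continuous fun p : E × ℝ =>
        (fderiv ℝ G p).comp (ContinuousLinearMap.inl ℝ E ℝ) :=
      (hG.continuous_fderiv (by simp)).clm_comp continuous_const
    obtain ⟨C, hC⟩ := ((isCompact_closedBall y 1).prod (isCompact_Icc (a := (0 : ℝ)) (b := 1)))
      |>.exists_bound_of_continuousOn hc.continuousOn
    refine intervalIntegral.hasFDerivAt_integral_of_dominated_of_fderiv_le
      (F := fun y s => G (y, s))
      (F' := fun y s => (fderiv ℝ G (y, s)).comp (ContinuousLinearMap.inl ℝ E ℝ))
      (bound := fun _ => C) (Metric.closedBall_mem_nhds y one_pos) ?_ ?_ ?_ ?_ ?_ ?_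
    · exact Eventually.of_forall fun x =>
        (hG.continuous.comp (by fun_prop : Continuous fun s : ℝ => (x, s))).aestronglyMeasurable
    · exact (hG.continuous.comp (by fun_prop : Continuous fun s : ℝ => (y, s))).intervalIntegrable _ _
    · exact (hc.comp (by fun_prop : Continuous fun s : ℝ => (y, s))).aestronglyMeasurable
    · refine ae_of_all _ fun s hs x hx => hC (x, s) ⟨hx, ?_⟩
      rw [uIoc_of_le zero_le_one] at hs
      exact Ioc_subset_Icc_self hs
    · exact intervalIntegrable_const
    · exact ae_of_all _ fun s _ x _ =>
        ((hG.differentiable (by simp)) (x, s)).hasFDerivAt.comp x (hasFDerivAt_prodMk_left x s)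
  induction k generalizing F with
  | zero =>
    rw [Nat.cast_zero, contDiff_zero]
    exact continuous_iff_continuousAt.2 fun y => (key hG y).continuousAt
  | succ k ih =>
    rw [Nat.cast_add, Nat.cast_one, contDiff_succ_iff_hasFDerivAt]
    refine ⟨_, ih (G := fun p => (fderiv ℝ G p).comp (ContinuousLinearMap.inl ℝ E ℝ)) ?_, key hG⟩
    exact (hG.fderiv_right (by simp)).clm_comp contDiff_const

/-- **Hadamard's lemma**: a smooth function is its value at a point plus a smooth family of linear
forms applied to the displacement. -/
theorem ContDiff.exists_eq_add_clm_apply_sub {E : Type} [NormedAddCommGroup E] [NormedSpace ℝ E]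
    [FiniteDimensional ℝ E] {f : E → ℝ} (hf : ContDiff ℝ ∞ f) (p : E) :
    ∃ A : E → E →L[ℝ] ℝ, ContDiff ℝ ∞ A ∧ A p = fderiv ℝ f p ∧
      ∀ y, f y = f p + A y (y - p) := by
  have hG : ContDiff ℝ ∞ fun q : E × ℝ => fderiv ℝ f (p + q.2 • (q.1 - p)) :=
    (hf.fderiv_right (m := ∞) (by simp)).comp (by fun_prop)
  refine ⟨fun y => ∫ s in (0 : ℝ)..1, fderiv ℝ f (p + s • (y - p)),
    contDiff_infty.2 fun k => contDiff_natCast_integral_unitInterval k hG, by simp, fun y => ?_⟩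
  have hc : Continuous fun s : ℝ => fderiv ℝ f (p + s • (y - p)) :=
    (hf.continuous_fderiv (by simp)).comp (by fun_prop)
  rw [ContinuousLinearMap.intervalIntegral_apply (hc.intervalIntegrable _ _)]
  have h1 : ∀ s : ℝ, HasDerivAt (fun s : ℝ => f (p + s • (y - p)))
      (fderiv ℝ f (p + s • (y - p)) (y - p)) s := fun s =>
    ((hf.differentiable (by simp)) _).hasFDerivAt.comp_hasDerivAt s
      (by simpa using ((hasDerivAt_id s).smul_const (y - p)).const_add p)
  rw [intervalIntegral.integral_eq_sub_of_hasDerivAt (fun s _ => h1 s)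
    ((hc.clm_apply continuous_const).intervalIntegrable _ _)]
  simp

end Calculus

section TestFunctions

/-- Smooth real-valued functions with compact support. -/
def testFunctions (n : ℕ) (Q : Type*) [TopologicalSpace Q]
    [ChartedSpace (EuclideanSpace ℝ (Fin n)) Q] : NonUnitalSubalgebra ℝ (Q → ℝ) where
  carrier := {f | ContMDiff (𝓡 n) 𝓘(ℝ, ℝ) ∞ f ∧ HasCompactSupport f}
  add_mem' := fun {_ _} hf hg => ⟨hf.1.add hg.1, hf.2.add hg.2⟩
  zero_mem' := ⟨contMDiff_const, HasCompactSupport.zero⟩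
  mul_mem' := fun {_ _} hf hg => ⟨hf.1.mul hg.1, hf.2.mul_right⟩
  smul_mem' := fun c _ hf => ⟨(contMDiff_const (c := c)).mul hf.1, hf.2.smul_left⟩

variable {n : ℕ} {Q : Type*} [TopologicalSpace Q] [ChartedSpace (EuclideanSpace ℝ (Fin n)) Q]

theorem testFunctions_le_smoothZeroAtInfty : testFunctions n Q ≤ smoothZeroAtInfty n Q := by
  rintro f ⟨h1, h2⟩
  refine ⟨h1, (tendsto_const_nhds (x := (0 : ℝ))).congr' ?_⟩
  filter_upwards [h2.compl_mem_cocompact] with x hx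
  exact (image_eq_zero_of_notMem_tsupport hx).symm

theorem sigmaCompactSpace_of_chartedSpace_euclideanSpace (n : ℕ) (Q : Type*) [TopologicalSpace Q]
    [SecondCountableTopology Q] [ChartedSpace (EuclideanSpace ℝ (Fin n)) Q] :
    SigmaCompactSpace Q :=
  have := ChartedSpace.locallyCompactSpace (EuclideanSpace ℝ (Fin n)) Q
  inferInstance

variable [T2Space Q] [SecondCountableTopology Q] [IsManifold (𝓡 n) ∞ Q]

theorem exists_testFunction_eq_one_nhds {K U : Set Q} (hK : IsCompact K) (hU : IsOpen U)
    (hKU : K ⊆ U) : ∃ f : testFunctions n Q, (∀ᶠ x in 𝓝ˢ K, f.1 x = 1) ∧ tsupport f.1 ⊆ U ∧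
      ∀ x, f.1 x ∈ Icc 0 1 := by
  have := ChartedSpace.locallyCompactSpace (EuclideanSpace ℝ (Fin n)) Q
  obtain ⟨L, hL, hKL, hLU⟩ := exists_compact_between hK hU hKU
  obtain ⟨f, h1, h2, h3⟩ := exists_contMDiffMap_one_nhds_of_subset_interior (n := ⊤) (𝓡 n)
    hK.isClosed hKL
  have hs : tsupport f ⊆ L := closure_minimal (fun x hx => by_contra fun h => hx (h2 x h))
    hL.isClosed
  exact ⟨⟨f, f.contMDiff, hL.of_isClosed_subset (isClosed_tsupport _) hs⟩, h1, hs.trans hLU, h3⟩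

theorem exists_testFunction_eventuallyEq_one {p : Q} {U : Set Q} (hU : U ∈ 𝓝 p) :
    ∃ f : testFunctions n Q, f.1 =ᶠ[𝓝 p] 1 ∧ tsupport f.1 ⊆ U ∧ ∀ x, f.1 x ∈ Icc 0 1 := by
  obtain ⟨f, h1, h2, h3⟩ := exists_testFunction_eq_one_nhds (n := n) isCompact_singleton
    isOpen_interior (singleton_subset_iff.2 (mem_interior_iff_mem_nhds.2 hU))
  rw [nhdsSet_singleton] at h1
  exact ⟨f, h1, h2.trans interior_subset, h3⟩

end TestFunctions

section ChartExtend

variable {n : ℕ} {Q : Type*} [TopologicalSpace Q]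
  {F : Type*} [NormedAddCommGroup F]

/-- The expression of a function in a chart, extended by zero off the target. -/
noncomputable def chartExtend (e : OpenPartialHomeomorph Q (EuclideanSpace ℝ (Fin n))) (g : Q → F) :
    EuclideanSpace ℝ (Fin n) → F :=
  e.target.indicator (g ∘ e.symm)

theorem chartExtend_apply (e : OpenPartialHomeomorph Q (EuclideanSpace ℝ (Fin n))) (g : Q → F)
    {q : Q} (hq : q ∈ e.source) : chartExtend e g (e q) = g q := by
  rw [chartExtend, indicator_of_mem (e.map_source hq), Function.comp_apply, e.left_inv hq]

variable {e : OpenPartialHomeomorph Q (EuclideanSpace ℝ (Fin n))} {g : Q → F}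

theorem tsupport_chartExtend_subset (hg : HasCompactSupport g) (hs : tsupport g ⊆ e.source) :
    tsupport (chartExtend e g) ⊆ e '' tsupport g := by
  refine closure_minimal (fun y hy => ?_)
    (hg.isCompact.image_of_continuousOn (e.continuousOn.mono hs)).isClosed
  have hyt : y ∈ e.target := by
    by_contra h
    exact hy (indicator_of_notMem h _)
  refine ⟨e.symm y, subset_tsupport _ fun h => hy ?_, e.right_inv hyt⟩
  rw [chartExtend, indicator_of_mem hyt, Function.comp_apply, h]

theorem hasCompactSupport_chartExtend (hg : HasCompactSupport g) (hs : tsupport g ⊆ e.source) :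
    HasCompactSupport (chartExtend e g) :=
  (hg.isCompact.image_of_continuousOn (e.continuousOn.mono hs)).of_isClosed_subset
    (isClosed_tsupport _) (tsupport_chartExtend_subset hg hs)

variable [ChartedSpace (EuclideanSpace ℝ (Fin n)) Q] [NormedSpace ℝ F] {x₀ : Q}

theorem contMDiff_of_contMDiffOn_of_tsupport_subset {U : Set Q} (hU : IsOpen U)
    (hg : ContMDiffOn (𝓡 n) 𝓘(ℝ, F) ∞ g U) (hs : tsupport g ⊆ U) :
    ContMDiff (𝓡 n) 𝓘(ℝ, F) ∞ g :=
  contMDiff_of_tsupport fun _ hx => hg.contMDiffAt (hU.mem_nhds (hs hx))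

/-- A function smooth on the source of a chart, multiplied by a cutoff. -/
theorem mul_mem_testFunctions {f : testFunctions n Q} {h : Q → ℝ} {U : Set Q} (hU : IsOpen U)
    (hs : tsupport f.1 ⊆ U) (hh : ContMDiffOn (𝓡 n) 𝓘(ℝ, ℝ) ∞ h U) :
    f.1 * h ∈ testFunctions n Q :=
  ⟨contMDiff_of_contMDiffOn_of_tsupport_subset hU (f.2.1.contMDiffOn.mul hh)
    ((tsupport_mul_subset_left).trans hs), f.2.2.mul_right⟩

variable [IsManifold (𝓡 n) ∞ Q]

theorem contDiff_chartExtend (hgs : ContMDiffOn (𝓡 n) 𝓘(ℝ, F) ∞ g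
      (chartAt (EuclideanSpace ℝ (Fin n)) x₀).source)
    (hg : HasCompactSupport g)
    (hs : tsupport g ⊆ (chartAt (EuclideanSpace ℝ (Fin n)) x₀).source) :
    ContDiff ℝ ∞ (chartExtend (chartAt (EuclideanSpace ℝ (Fin n)) x₀) g) := by
  set e := chartAt (EuclideanSpace ℝ (Fin n)) x₀ with he
  refine contMDiff_iff_contDiff.1 (contMDiff_of_tsupport fun y hy => ?_)
  obtain ⟨q, hq, rfl⟩ := tsupport_chartExtend_subset hg hs hy
  have hyt : e.target ∈ 𝓝 (e q) := e.open_target.mem_nhds (e.map_source (hs hq))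
  have h1 : ContMDiffAt (𝓡 n) 𝓘(ℝ, F) ∞ (g ∘ e.symm) (e q) := by
    refine ContMDiffAt.comp (I' := 𝓡 n) _ ?_ ((contMDiffOn_chart_symm (x := x₀)).contMDiffAt hyt)
    rw [e.left_inv (hs hq)]
    exact hgs.contMDiffAt (e.open_source.mem_nhds (hs hq))
  refine h1.congr_of_eventuallyEq ?_
  filter_upwards [hyt] with y hy using indicator_of_mem hy _

theorem contMDiffOn_comp_chartAt {G : EuclideanSpace ℝ (Fin n) → F} (hG : ContDiff ℝ ∞ G) :
    ContMDiffOn (𝓡 n) 𝓘(ℝ, F) ∞ (fun q => G (chartAt (EuclideanSpace ℝ (Fin n)) x₀ q))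
      (chartAt (EuclideanSpace ℝ (Fin n)) x₀).source :=
  hG.contMDiff.comp_contMDiffOn contMDiffOn_chart

end ChartExtend

section Derivation

variable {n : ℕ} {Q : Type*} [TopologicalSpace Q] [ChartedSpace (EuclideanSpace ℝ (Fin n)) Q]
  [T2Space Q] [SecondCountableTopology Q] [IsManifold (𝓡 n) ∞ Q]
  {X : testFunctions n Q →ₗ[ℝ] (Q → ℂ)}

theorem derivation_eq_zero_of_eventuallyEq_zero
    (hX : ∀ (f g : testFunctions n Q) x, X (f * g) x = f.1 x * X g x + g.1 x * X f x)
    {f : testFunctions n Q} {p : Q} (hf : f.1 =ᶠ[𝓝 p] 0) : X f p = 0 := by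
  obtain ⟨b, hb1, hb2, -⟩ := exists_testFunction_eventuallyEq_one (n := n) hf
  have h0 : b * f = 0 := by
    ext x
    change b.1 x * f.1 x = 0
    by_cases hx : x ∈ tsupport b.1
    · rw [show f.1 x = 0 from hb2 hx, mul_zero]
    · rw [image_eq_zero_of_notMem_tsupport hx, zero_mul]
  have h1 := hX b f p
  rw [h0, map_zero, hb1.eq_of_nhds, hf.eq_of_nhds] at h1
  simpa using h1.symm

theorem derivation_congr_of_eventuallyEq
    (hX : ∀ (f g : testFunctions n Q) x, X (f * g) x = f.1 x * X g x + g.1 x * X f x)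
    {f g : testFunctions n Q} {p : Q} (hf : f.1 =ᶠ[𝓝 p] g.1) : X f p = X g p := by
  have : X (f - g) p = 0 := derivation_eq_zero_of_eventuallyEq_zero hX <| by
    filter_upwards [hf] with x hx
    change f.1 x - g.1 x = 0
    rw [hx, sub_self]
  rwa [map_sub, Pi.sub_apply, sub_eq_zero] at this

theorem derivation_eq_zero_of_eventuallyEq_one
    (hX : ∀ (f g : testFunctions n Q) x, X (f * g) x = f.1 x * X g x + g.1 x * X f x)
    {f : testFunctions n Q} {p : Q} (hf : f.1 =ᶠ[𝓝 p] 1) : X f p = 0 := by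
  have h1 : X (f * f) p = X f p := derivation_congr_of_eventuallyEq hX <| by
    filter_upwards [hf] with x hx
    change f.1 x * f.1 x = f.1 x
    simp [hx]
  rw [hX, hf.eq_of_nhds] at h1
  simpa using h1

/-- A derivation of the algebra of test functions is, in a chart, a first order differential
operator. -/
theorem derivation_apply_eq_sum
    (hX : ∀ (f g : testFunctions n Q) x, X (f * g) x = f.1 x * X g x + g.1 x * X f x)
    {x₀ p : Q} (hp : p ∈ (chartAt (EuclideanSpace ℝ (Fin n)) x₀).source)
    {ξ : Fin n → testFunctions n Q}
    (hξ : ∀ i, (ξ i).1 =ᶠ[𝓝 p] fun q => chartAt (EuclideanSpace ℝ (Fin n)) x₀ q i)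
    (f : testFunctions n Q) {F : EuclideanSpace ℝ (Fin n) → ℝ} (hF : ContDiff ℝ ∞ F)
    (hfF : f.1 =ᶠ[𝓝 p] fun q => F (chartAt (EuclideanSpace ℝ (Fin n)) x₀ q)) :
    X f p = ∑ i, fderiv ℝ F (chartAt (EuclideanSpace ℝ (Fin n)) x₀ p)
      (EuclideanSpace.single i 1) * X (ξ i) p := by
  set e := chartAt (EuclideanSpace ℝ (Fin n)) x₀ with he
  obtain ⟨A, hA, hAp, hFA⟩ := hF.exists_eq_add_clm_apply_sub (e p)
  obtain ⟨ζ, hζ1, hζ2, -⟩ := exists_testFunction_eventuallyEq_one (n := n)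
    (e.open_source.mem_nhds hp)
  let α : Fin n → testFunctions n Q := fun i =>
    ⟨ζ.1 * fun q => A (e q) (EuclideanSpace.single i 1), mul_mem_testFunctions e.open_source hζ2
      (contMDiffOn_comp_chartAt (G := fun y => A y (EuclideanSpace.single i 1))
        (hA.clm_apply contDiff_const))⟩
  have hαp : ∀ i, (α i).1 p = fderiv ℝ F (e p) (EuclideanSpace.single i 1) := fun i => by
    change ζ.1 p * A (e p) _ = _
    rw [hζ1.eq_of_nhds, hAp, Pi.one_apply, one_mul]
  have hξp : ∀ i, (ξ i).1 p = e p i := fun i => (hξ i).eq_of_nhds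
  have hf : f.1 =ᶠ[𝓝 p] (F (e p) • ζ + ∑ i, (ξ i - e p i • ζ) * α i : testFunctions n Q).1 := by
    filter_upwards [hfF, hζ1, eventually_all.2 hξ] with q h1 h2 h3
    have h4 : (F (e p) • ζ + ∑ i, (ξ i - e p i • ζ) * α i : testFunctions n Q).1 q =
        F (e p) * ζ.1 q + ∑ i, ((ξ i).1 q - e p i * ζ.1 q) *
          (ζ.1 q * A (e q) (EuclideanSpace.single i 1)) := by
      simp only [NonUnitalSubalgebra.coe_add, NonUnitalSubalgebra.coe_smul, Pi.add_apply,
        Pi.smul_apply, smul_eq_mul]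
      congr 1
      have : ∀ s : Finset (Fin n), (∑ i ∈ s, (ξ i - e p i • ζ) * α i : testFunctions n Q).1 =
          ∑ i ∈ s, ((ξ i - e p i • ζ) * α i : testFunctions n Q).1 := fun s =>
        map_sum (NonUnitalSubalgebraClass.subtype (testFunctions n Q)) _ s
      rw [this, Finset.sum_apply]
      rfl
    rw [h1, h4, h2, hFA]
    simp only [Pi.one_apply, mul_one, one_mul, h3]
    congr 1
    conv_lhs => rw [← (EuclideanSpace.basisFun (Fin n) ℝ).sum_repr (e q - e p)]
    rw [map_sum]
    refine Finset.sum_congr rfl fun i _ => ?_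
    simp
  rw [derivation_congr_of_eventuallyEq hX hf, map_add, map_smul, map_sum, Pi.add_apply,
    Pi.smul_apply, derivation_eq_zero_of_eventuallyEq_one hX hζ1, smul_zero, zero_add,
    Finset.sum_apply]
  refine Finset.sum_congr rfl fun i _ => ?_
  have h5 : (ξ i - e p i • ζ : testFunctions n Q).1 p = 0 := by
    change (ξ i).1 p - e p i * ζ.1 p = 0
    rw [hξp, hζ1.eq_of_nhds, Pi.one_apply, mul_one, sub_self]
  rw [hX, h5, hαp, map_sub, map_smul, Pi.sub_apply, Pi.smul_apply,
    derivation_eq_zero_of_eventuallyEq_one hX hζ1]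
  simp

end Derivation

section SmoothDensity

variable {n : ℕ} {Q : Type*} [TopologicalSpace Q] [ChartedSpace (EuclideanSpace ℝ (Fin n)) Q]
  [MeasurableSpace Q] [BorelSpace Q] {μ : Measure Q}

theorem IsSmoothDensity.isLocallyFiniteMeasure [T2Space Q] (hμ : IsSmoothDensity n μ) :
    IsLocallyFiniteMeasure μ := by
  refine ⟨fun x₀ => ?_⟩
  have := ChartedSpace.locallyCompactSpace (EuclideanSpace ℝ (Fin n)) Q
  obtain ⟨ρ, hρ, -, hρμ⟩ := hμ x₀
  set e := chartAt (EuclideanSpace ℝ (Fin n)) x₀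
  obtain ⟨L, hL, hLs, hLc⟩ := local_compact_nhds
    (e.open_source.mem_nhds (mem_chart_source (EuclideanSpace ℝ (Fin n)) x₀))
  refine ⟨L, hL, ?_⟩
  have hc : IsCompact (e '' L) := hLc.image_of_continuousOn (e.continuousOn.mono hLs)
  obtain ⟨C, hC⟩ := hc.exists_bound_of_continuousOn (f := ρ)
    (hρ.continuousOn.mono (by rintro _ ⟨q, hq, rfl⟩; exact e.map_source (hLs hq)))
  rw [hρμ L hLc.measurableSet hLs]
  calc ∫⁻ y in e '' L, ENNReal.ofReal (ρ y) ≤ ∫⁻ _ in e '' L, ENNReal.ofReal C :=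
        setLIntegral_mono measurable_const fun y hy =>
          ENNReal.ofReal_le_ofReal ((le_abs_self _).trans (hC y hy))
    _ < ⊤ := by
        rw [setLIntegral_const]
        exact ENNReal.mul_lt_top ENNReal.ofReal_lt_top hc.measure_lt_top

theorem IsSmoothDensity.isOpenPosMeasure (hμ : IsSmoothDensity n μ) :
    μ.IsOpenPosMeasure := by
  refine ⟨fun U hU ⟨x₀, hx₀⟩ h0 => ?_⟩
  obtain ⟨ρ, hρ, hpos, hρμ⟩ := hμ x₀
  set e := chartAt (EuclideanSpace ℝ (Fin n)) x₀
  have hs : x₀ ∈ e.source := mem_chart_source _ x₀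
  have h1 := hρμ (U ∩ e.source) (hU.inter e.open_source).measurableSet inter_subset_right
  rw [measure_mono_null inter_subset_left h0] at h1
  have ho : IsOpen (e '' (U ∩ e.source)) :=
    e.isOpen_image_of_subset_source (hU.inter e.open_source) inter_subset_right
  have ht : e '' (U ∩ e.source) ⊆ e.target := by
    rintro _ ⟨q, hq, rfl⟩
    exact e.map_source hq.2
  have h2 := (lintegral_eq_zero_iff' (((hρ.continuousOn.mono ht).aemeasurable
    ho.measurableSet).ennreal_ofReal)).1 h1.symm
  have h3 : ∀ᵐ y ∂(volume.restrict (e '' (U ∩ e.source))), False := by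
    filter_upwards [h2, ae_restrict_mem ho.measurableSet] with y hy hy'
    exact absurd hy (by simpa using hpos y (ht hy'))
  rw [ae_iff] at h3
  simp only [not_false_eq_true, ofPred_true, Measure.restrict_apply_univ] at h3
  exact (ho.measure_pos volume ⟨e x₀, mem_image_of_mem e ⟨hx₀, hs⟩⟩).ne' h3

theorem integral_eq_setIntegral_chartAt_target {F : Type*} [NormedAddCommGroup F]
    [NormedSpace ℝ F] [SecondCountableTopology Q] {x₀ : Q}
    {ρ : EuclideanSpace ℝ (Fin n) → ℝ}
    (hρ : ContinuousOn ρ (chartAt (EuclideanSpace ℝ (Fin n)) x₀).target)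
    (hpos : ∀ y ∈ (chartAt (EuclideanSpace ℝ (Fin n)) x₀).target, 0 < ρ y)
    (hρμ : ∀ B : Set Q, MeasurableSet B → B ⊆ (chartAt (EuclideanSpace ℝ (Fin n)) x₀).source →
      μ B = ∫⁻ y in chartAt (EuclideanSpace ℝ (Fin n)) x₀ '' B, ENNReal.ofReal (ρ y))
    {g : Q → F} (hg : StronglyMeasurable g)
    (hs : ∀ x ∉ (chartAt (EuclideanSpace ℝ (Fin n)) x₀).source, g x = 0) :
    ∫ x, g x ∂μ = ∫ y in (chartAt (EuclideanSpace ℝ (Fin n)) x₀).target,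
      ρ y • g ((chartAt (EuclideanSpace ℝ (Fin n)) x₀).symm y) := by
  set e := chartAt (EuclideanSpace ℝ (Fin n)) x₀
  have hm : MeasurableSet e.target := e.open_target.measurableSet
  have hρm : AEMeasurable (fun y => ENNReal.ofReal (ρ y)) (volume.restrict e.target) :=
    (hρ.aemeasurable hm).ennreal_ofReal
  have hem : AEMeasurable e.symm
      ((volume.restrict e.target).withDensity fun y => ENNReal.ofReal (ρ y)) :=
    (e.continuousOn_symm.aemeasurable hm).mono_ac (withDensity_absolutelyContinuous _ _)
  have hmap : μ.restrict e.source = Measure.map e.symm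
      ((volume.restrict e.target).withDensity fun y => ENNReal.ofReal (ρ y)) := by
    ext B hB
    have himg : e '' (B ∩ e.source) = e.symm ⁻¹' B ∩ e.target := by
      ext y
      constructor
      · rintro ⟨q, hq, rfl⟩
        exact ⟨by rw [mem_preimage, e.left_inv hq.2]; exact hq.1, e.map_source hq.2⟩
      · rintro ⟨h1, h2⟩
        exact ⟨e.symm y, ⟨h1, e.map_target h2⟩, e.right_inv h2⟩
    rw [Measure.restrict_apply hB, hρμ _ (hB.inter e.open_source.measurableSet)
      inter_subset_right, Measure.map_apply_of_aemeasurable hem hB, withDensity_apply',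
      Measure.restrict_restrict' hm, himg]
  rw [← setIntegral_eq_integral_of_forall_compl_eq_zero hs, hmap,
    integral_map hem hg.aestronglyMeasurable,
    integral_withDensity_eq_integral_toReal_smul₀ hρm (by simp)]
  refine setIntegral_congr_fun hm fun y hy => ?_
  simp only [ENNReal.toReal_ofReal (hpos y hy).le]

variable [T2Space Q] [SecondCountableTopology Q] [IsManifold (𝓡 n) ∞ Q]

/-- The integral of a derivation supported in a chart domain against a smooth density: integrating
by parts moves the derivative off the test function. -/
theorem exists_integral_derivation_eq (hμ : IsSmoothDensity n μ)
    {X : testFunctions n Q →ₗ[ℝ] (Q → ℂ)}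
    (hX : ∀ (f g : testFunctions n Q) x, X (f * g) x = f.1 x * X g x + g.1 x * X f x)
    (hXs : ∀ f, ContMDiff (𝓡 n) 𝓘(ℝ, ℂ) ∞ (X f)) {x₀ : Q} {K : Set Q} (hK : IsCompact K)
    (hKs : K ⊆ (chartAt (EuclideanSpace ℝ (Fin n)) x₀).source)
    (hX0 : ∀ f, ∀ x ∉ K, X f x = 0) :
    ∃ w : Q → ℂ, ContMDiff (𝓡 n) 𝓘(ℝ, ℂ) ∞ w ∧
      ∀ f : testFunctions n Q, ∫ x, X f x ∂μ = ∫ x, f.1 x • w x ∂μ := by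
  obtain ⟨ρ, hρ, hpos, hρμ⟩ := hμ x₀
  have hint := fun {g : Q → ℂ} => integral_eq_setIntegral_chartAt_target (μ := μ) (g := g)
    hρ.continuousOn hpos hρμ
  have hρe : ContMDiffOn (𝓡 n) 𝓘(ℝ, ℝ) ∞
      (fun q => ρ (chartAt (EuclideanSpace ℝ (Fin n)) x₀ q))
      (chartAt (EuclideanSpace ℝ (Fin n)) x₀).source :=
    hρ.contMDiffOn.comp contMDiffOn_chart
      (chartAt (EuclideanSpace ℝ (Fin n)) x₀).mapsTo
  obtain ⟨η, hη1, hη2, -⟩ := exists_testFunction_eq_one_nhds (n := n) hK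
    (chartAt (EuclideanSpace ℝ (Fin n)) x₀).open_source hKs
  have hηp : ∀ p ∈ K, η.1 =ᶠ[𝓝 p] 1 := fun p hp => hη1.filter_mono (nhds_le_nhdsSet hp)
  let ξ : Fin n → testFunctions n Q := fun i =>
    ⟨η.1 * fun q => chartAt (EuclideanSpace ℝ (Fin n)) x₀ q i,
      mul_mem_testFunctions (chartAt (EuclideanSpace ℝ (Fin n)) x₀).open_source hη2
      (contMDiffOn_comp_chartAt (G := fun y : EuclideanSpace ℝ (Fin n) => y i)
        (EuclideanSpace.proj (𝕜 := ℝ) i).contDiff)⟩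
  let γ : Fin n → Q → ℂ := fun i q =>
    ρ (chartAt (EuclideanSpace ℝ (Fin n)) x₀ q) • X (ξ i) q
  have hγK : ∀ i, tsupport (γ i) ⊆ K := fun i => closure_minimal (fun q hq => by
    by_contra h
    exact hq (by simp only [γ, hX0 _ q h, smul_zero])) hK.isClosed
  have hγc : ∀ i, HasCompactSupport (γ i) := fun i =>
    hK.of_isClosed_subset (isClosed_tsupport _) (hγK i)
  let Y : Fin n → EuclideanSpace ℝ (Fin n) → ℂ := fun i =>
    chartExtend (chartAt (EuclideanSpace ℝ (Fin n)) x₀) (γ i)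
  have hY : ∀ i, ContDiff ℝ ∞ (Y i) := fun i =>
    contDiff_chartExtend (hρe.smul (hXs _).contMDiffOn) (hγc i) ((hγK i).trans hKs)
  have hYs : ∀ i, tsupport (Y i) ⊆ chartAt (EuclideanSpace ℝ (Fin n)) x₀ '' K := fun i =>
    (tsupport_chartExtend_subset (hγc i) ((hγK i).trans hKs)).trans (image_mono (hγK i))
  have hYc : ∀ i, HasCompactSupport (Y i) := fun i =>
    hasCompactSupport_chartExtend (hγc i) ((hγK i).trans hKs)
  set e := chartAt (EuclideanSpace ℝ (Fin n)) x₀ with he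
  let D : EuclideanSpace ℝ (Fin n) → ℂ := fun y =>
    ∑ i, fderiv ℝ (Y i) y (EuclideanSpace.single i 1)
  have hD : ContDiff ℝ ∞ D := ContDiff.sum fun i _ =>
    ((hY i).fderiv_right (m := ∞) (by simp)).clm_apply contDiff_const
  have hDK : ∀ y, D y ≠ 0 → y ∈ e '' K := fun y hy => by
    obtain ⟨i, -, hi⟩ := Finset.exists_ne_zero_of_sum_ne_zero hy
    refine hYs i (support_fderiv_subset ℝ (f := Y i) fun h => hi ?_)
    rw [h]
    rfl
  let w : Q → ℂ := e.source.indicator fun q => -((ρ (e q))⁻¹ • D (e q))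
  have hwK : tsupport w ⊆ K := closure_minimal (fun q hq => by
    have hqs : q ∈ e.source := by
      by_contra h
      exact hq (indicator_of_notMem h _)
    have : D (e q) ≠ 0 := fun h => hq (by simp only [w, indicator_of_mem hqs, h, smul_zero, neg_zero])
    obtain ⟨q', h1, h2⟩ := hDK _ this
    rwa [← e.injOn (hKs h1) hqs h2]) hK.isClosed
  have hw : ContMDiff (𝓡 n) 𝓘(ℝ, ℂ) ∞ w := by
    refine contMDiff_of_contMDiffOn_of_tsupport_subset e.open_source ?_ (hwK.trans hKs)
    have : ContMDiffOn (𝓡 n) 𝓘(ℝ, ℂ) ∞ (fun q => -((ρ (e q))⁻¹ • D (e q))) e.source :=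
      ((hρe.inv₀ fun q hq => (hpos _ (e.map_source hq)).ne').smul
        (contMDiffOn_comp_chartAt hD)).neg
    exact this.congr fun q hq => indicator_of_mem hq _
  refine ⟨w, hw, fun f => ?_⟩
  have hηf : tsupport (η * f : testFunctions n Q).1 ⊆ e.source :=
    (tsupport_mul_subset_left (f := η.1) (g := f.1)).trans hη2
  let F : EuclideanSpace ℝ (Fin n) → ℝ := chartExtend e (η * f : testFunctions n Q).1
  have hF : ContDiff ℝ ∞ F :=
    contDiff_chartExtend (η * f).2.1.contMDiffOn (η * f).2.2 hηf
  have hFc : HasCompactSupport F := hasCompactSupport_chartExtend (η * f).2.2 hηf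
  have hFK : ∀ q ∈ K, F (e q) = f.1 q := fun q hq => by
    change chartExtend e _ (e q) = _
    rw [chartExtend_apply e _ (hKs hq)]
    change η.1 q * f.1 q = _
    rw [(hηp q hq).eq_of_nhds, Pi.one_apply, one_mul]
  have h1 : ∀ y ∈ e.target, ρ y • X f (e.symm y) =
      ∑ i, fderiv ℝ F y (EuclideanSpace.single i 1) • Y i y := fun y hy => by
    have hYy : ∀ i, Y i y = ρ y • X (ξ i) (e.symm y) := fun i => by
      change chartExtend e (γ i) y = _
      rw [chartExtend, indicator_of_mem hy, Function.comp_apply]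
      change ρ (e (e.symm y)) • _ = _
      rw [e.right_inv hy]
    by_cases hq : e.symm y ∈ K
    · have hXf := derivation_apply_eq_sum hX (hKs hq) (ξ := ξ) (fun i => by
        filter_upwards [hηp _ hq] with q h
        change η.1 q * _ = _
        rw [h, Pi.one_apply, one_mul]) f hF (by
        filter_upwards [hηp _ hq, e.open_source.mem_nhds (hKs hq)] with q h h'
        change _ = chartExtend e _ (e q)
        rw [chartExtend_apply e _ h']
        change _ = η.1 q * _
        rw [h, Pi.one_apply, one_mul])
      rw [← he, e.right_inv hy] at hXf
      rw [hXf, Finset.smul_sum]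
      refine Finset.sum_congr rfl fun i _ => ?_
      rw [hYy, Complex.real_smul, Complex.real_smul, Complex.real_smul]
      ring
    · rw [hX0 f _ hq, smul_zero]
      exact (Finset.sum_eq_zero fun i _ => by rw [hYy, hX0 _ _ hq, smul_zero, smul_zero]).symm
  have h2 : ∀ y ∈ e.target, ρ y • f.1 (e.symm y) • w (e.symm y) = -(F y • D y) := fun y hy => by
    change _ • _ • e.source.indicator _ _ = _
    rw [indicator_of_mem (e.map_target hy), e.right_inv hy]
    by_cases hDy : D y = 0
    · rw [hDy]
      simp
    · obtain ⟨q, hq, rfl⟩ := hDK y hDy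
      rw [e.left_inv (hKs hq), hFK q hq, smul_comm, smul_neg, smul_inv_smul₀ (hpos _ hy).ne',
        smul_neg]
  have hYt : ∀ y ∉ e.target, ∑ i, fderiv ℝ F y (EuclideanSpace.single i 1) • Y i y = 0 :=
    fun y hy => Finset.sum_eq_zero fun i _ => by
      rw [show Y i y = 0 from indicator_of_notMem hy _, smul_zero]
  have hDt : ∀ y ∉ e.target, -(F y • D y) = 0 := fun y hy => by
    rw [show F y = 0 from indicator_of_notMem hy _, zero_smul, neg_zero]
  have hF' : ∀ i, ContDiff ℝ ∞ fun y => fderiv ℝ F y (EuclideanSpace.single i 1) := fun i =>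
    (hF.fderiv_right (m := ∞) (by simp)).clm_apply contDiff_const
  have hY' : ∀ i, ContDiff ℝ ∞ fun y => fderiv ℝ (Y i) y (EuclideanSpace.single i 1) := fun i =>
    ((hY i).fderiv_right (m := ∞) (by simp)).clm_apply contDiff_const
  have i1 : ∀ i, Integrable fun y => fderiv ℝ F y (EuclideanSpace.single i 1) • Y i y := fun i =>
    ((hF' i).continuous.smul (hY i).continuous).integrable_of_hasCompactSupport (hYc i).smul_left
  have i2 : ∀ i, Integrable fun y => F y • fderiv ℝ (Y i) y (EuclideanSpace.single i 1) :=
    fun i => (hF.continuous.smul (hY' i).continuous).integrable_of_hasCompactSupport hFc.smul_right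
  have i3 : ∀ i, Integrable fun y => F y • Y i y := fun i =>
    (hF.continuous.smul (hY i).continuous).integrable_of_hasCompactSupport hFc.smul_right
  rw [hint (hXs f).continuous.stronglyMeasurable fun x hx => hX0 f x fun h => hx (hKs h),
    hint (g := fun x => f.1 x • w x) (f.2.1.continuous.smul hw.continuous).stronglyMeasurable fun x hx => by
      rw [show w x = 0 from indicator_of_notMem hx _, smul_zero],
    setIntegral_congr_fun e.open_target.measurableSet h1,
    setIntegral_congr_fun e.open_target.measurableSet h2,
    setIntegral_eq_integral_of_forall_compl_eq_zero hYt,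
    setIntegral_eq_integral_of_forall_compl_eq_zero hDt,
    integral_finsetSum _ fun i _ => i1 i, integral_neg]
  simp only [D, Finset.smul_sum]
  rw [integral_finsetSum _ fun i _ => i2 i, ← Finset.sum_neg_distrib]
  refine Finset.sum_congr rfl fun i _ => ?_
  rw [integral_smul_fderiv_eq_neg_fderiv_smul_of_integrable (i1 i) (i2 i) (i3 i)
    (fun x _ => hF.differentiable (by simp) x) (fun x _ => (hY i).differentiable (by simp) x),
    neg_neg]

end SmoothDensity

section FrameLemmas

variable {n : ℕ} {Q : Type*} [TopologicalSpace Q] [ChartedSpace (EuclideanSpace ℝ (Fin n)) Q]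
  {E : Q → Type*} [∀ x, NormedAddCommGroup (E x)] [∀ x, InnerProductSpace ℂ (E x)]
  [TopologicalSpace (TotalSpace ℂ E)] [FiberBundle ℂ E] [VectorBundle ℂ ℂ E]

theorem eq_trivialization_smul_frame {x₀ x : Q} (hx : x ∈ (trivializationAt ℂ E x₀).baseSet)
    (v : E x) : v = (trivializationAt ℂ E x₀ ⟨x, v⟩).2 • (trivializationAt ℂ E x₀).symm x 1 := by
  have h1 : (trivializationAt ℂ E x₀).symm x (trivializationAt ℂ E x₀ ⟨x, v⟩).2 = v :=
    (trivializationAt ℂ E x₀).symm_apply_apply_mk hx v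
  have h2 := ((trivializationAt ℂ E x₀).symmₗ ℂ x).map_smul
    (trivializationAt ℂ E x₀ ⟨x, v⟩).2 1
  rw [smul_eq_mul, mul_one, Trivialization.coe_symmₗ _ hx] at h2
  exact h1.symm.trans h2

theorem frame_ne_zero {x₀ x : Q} (hx : x ∈ (trivializationAt ℂ E x₀).baseSet) :
    (trivializationAt ℂ E x₀).symm x (1 : ℂ) ≠ 0 := by
  intro h
  have h1 := congrArg Prod.snd ((trivializationAt ℂ E x₀).apply_mk_symm hx (1 : ℂ))
  rw [h, ((trivializationAt ℂ E x₀).linear ℂ hx).map_zero] at h1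
  exact zero_ne_one h1

theorem eq_inner_div_smul_of_ne_zero {x : Q} {e : E x} (he : e ≠ 0) (v : E x) :
    v = (inner ℂ e v / (‖e‖ ^ 2 : ℝ)) • e := by
  have hx := FiberBundle.mem_baseSet_trivializationAt ℂ E x
  have h1 := eq_trivialization_smul_frame hx v
  have h2 := eq_trivialization_smul_frame hx e
  set u := (trivializationAt ℂ E x).symm x (1 : ℂ)
  set a := (trivializationAt ℂ E x ⟨x, v⟩).2
  set b := (trivializationAt ℂ E x ⟨x, e⟩).2
  have hb : b ≠ 0 := fun h => he (by rw [h2, h, zero_smul])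
  have h3 : v = (a / b) • e := by rw [h1, h2, smul_smul, div_mul_cancel₀ _ hb]
  have h4 : inner ℂ e v / (‖e‖ ^ 2 : ℝ) = a / b := by
    rw [h3, inner_smul_right, inner_self_eq_norm_sq_to_K]
    have : ((‖e‖ : ℂ)) ^ 2 ≠ 0 := pow_ne_zero 2 (by simpa using he)
    push_cast
    exact mul_div_cancel_right₀ _ this
  rw [h4]
  exact h3

end FrameLemmas

section SmoothSections

theorem ContMDiffAt.complex_mul {n : ℕ} {Q : Type*} [TopologicalSpace Q]
    [ChartedSpace (EuclideanSpace ℝ (Fin n)) Q] {f g : Q → ℂ} {x : Q}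
    (hf : ContMDiffAt (𝓡 n) 𝓘(ℝ, ℂ) ∞ f x) (hg : ContMDiffAt (𝓡 n) 𝓘(ℝ, ℂ) ∞ g x) :
    ContMDiffAt (𝓡 n) 𝓘(ℝ, ℂ) ∞ (fun y => f y * g y) x :=
  ((contDiff_mul (𝕜 := ℝ) (𝔸 := ℂ)).contMDiff (n := ∞)).contMDiffAt.comp x (hf.prodMk_space hg)

theorem ContMDiff.complex_mul {n : ℕ} {Q : Type*} [TopologicalSpace Q]
    [ChartedSpace (EuclideanSpace ℝ (Fin n)) Q] {f g : Q → ℂ}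
    (hf : ContMDiff (𝓡 n) 𝓘(ℝ, ℂ) ∞ f) (hg : ContMDiff (𝓡 n) 𝓘(ℝ, ℂ) ∞ g) :
    ContMDiff (𝓡 n) 𝓘(ℝ, ℂ) ∞ fun y => f y * g y :=
  fun x => (hf x).complex_mul (hg x)

/-- The smooth compactly supported sections, as a subspace of the space of all sections. -/
def smoothCompactSections (n : ℕ) {Q : Type*} [TopologicalSpace Q]
    [ChartedSpace (EuclideanSpace ℝ (Fin n)) Q] (E : Q → Type*) [∀ x, NormedAddCommGroup (E x)]
    [∀ x, InnerProductSpace ℂ (E x)] [TopologicalSpace (TotalSpace ℂ E)] [FiberBundle ℂ E]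
    [VectorBundle ℂ ℂ E] [VectorBundle ℝ ℂ E] [ContMDiffVectorBundle ∞ ℂ E (𝓡 n)] :
    Submodule ℂ (∀ x, E x) where
  carrier := {σ | IsSmoothCompactSection n σ}
  add_mem' := by
    rintro σ τ ⟨h1, K, hK, hσK⟩ ⟨h2, L, hL, hτL⟩
    refine ⟨fun x => ?_, K ∪ L, hK.union hL, fun x hx => ?_⟩
    · have hx := (trivializationAt ℂ E x).open_baseSet.mem_nhds
        (FiberBundle.mem_baseSet_trivializationAt ℂ E x)
      refine (contMDiffAt_section x).2 ((((contMDiffAt_section x).1 (h1 x)).add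
        ((contMDiffAt_section x).1 (h2 x))).congr_of_eventuallyEq ?_)
      filter_upwards [hx] with y hy
      exact ((trivializationAt ℂ E x).linear ℂ hy).map_add _ _
    · rw [Pi.add_apply, hσK x fun h => hx (.inl h), hτL x fun h => hx (.inr h), add_zero]
  zero_mem' := by
    refine ⟨fun x => (contMDiffAt_section x).2 ?_, ∅, isCompact_empty, fun x _ => rfl⟩
    refine (contMDiffAt_const (c := (0 : ℂ))).congr_of_eventuallyEq ?_
    filter_upwards [(trivializationAt ℂ E x).open_baseSet.mem_nhds
      (FiberBundle.mem_baseSet_trivializationAt ℂ E x)] with y hy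
    exact ((trivializationAt ℂ E x).linear ℂ hy).map_zero
  smul_mem' := by
    rintro c σ ⟨h1, K, hK, hσK⟩
    refine ⟨fun x => ?_, K, hK, fun x hx => by rw [Pi.smul_apply, hσK x hx, smul_zero]⟩
    refine (contMDiffAt_section x).2 (((contMDiffAt_const (c := c)).complex_mul
      ((contMDiffAt_section x).1 (h1 x))).congr_of_eventuallyEq ?_)
    filter_upwards [(trivializationAt ℂ E x).open_baseSet.mem_nhds
      (FiberBundle.mem_baseSet_trivializationAt ℂ E x)] with y hy
    exact ((trivializationAt ℂ E x).linear ℂ hy).map_smul _ _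

variable {n : ℕ} {Q : Type*} [TopologicalSpace Q] [ChartedSpace (EuclideanSpace ℝ (Fin n)) Q]
  {E : Q → Type*} [∀ x, NormedAddCommGroup (E x)] [∀ x, InnerProductSpace ℂ (E x)]
  [TopologicalSpace (TotalSpace ℂ E)] [FiberBundle ℂ E] [VectorBundle ℂ ℂ E]
  [VectorBundle ℝ ℂ E] [ContMDiffVectorBundle ∞ ℂ E (𝓡 n)]

theorem smoothSection_contMDiffOn_trivialization (σ : smoothCompactSections n E) (x₀ : Q) :
    ContMDiffOn (𝓡 n) 𝓘(ℝ, ℂ) ∞ (fun x => (trivializationAt ℂ E x₀ ⟨x, σ.1 x⟩).2)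
      (trivializationAt ℂ E x₀).baseSet := fun x hx =>
  (((trivializationAt ℂ E x₀).contMDiffAt_section_iff hx).1 (σ.2.1 x)).contMDiffWithinAt

theorem smoothSection_smul_mem (σ : smoothCompactSections n E) {w : Q → ℂ}
    (hw : ContMDiff (𝓡 n) 𝓘(ℝ, ℂ) ∞ w) : (fun x => w x • σ.1 x) ∈ smoothCompactSections n E := by
  obtain ⟨h1, K, hK, hσK⟩ := σ.2
  refine ⟨fun x => ?_, K, hK, fun x hx => by simp only [hσK x hx, smul_zero]⟩
  refine (contMDiffAt_section x).2 (((hw x).complex_mul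
    ((contMDiffAt_section x).1 (h1 x))).congr_of_eventuallyEq ?_)
  filter_upwards [(trivializationAt ℂ E x).open_baseSet.mem_nhds
    (FiberBundle.mem_baseSet_trivializationAt ℂ E x)] with y hy
  exact ((trivializationAt ℂ E x).linear ℂ hy).map_smul _ _

/-- Multiplication of smooth compactly supported sections by a smooth function. -/
def smulSection (w : Q → ℂ) (hw : ContMDiff (𝓡 n) 𝓘(ℝ, ℂ) ∞ w) :
    smoothCompactSections n E →ₗ[ℂ] smoothCompactSections n E where
  toFun σ := ⟨fun x => w x • σ.1 x, smoothSection_smul_mem σ hw⟩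
  map_add' _ _ := Subtype.ext (funext fun _ => smul_add _ _ _)
  map_smul' _ _ := Subtype.ext (funext fun _ => smul_comm _ _ _)

theorem contMDiff_ofReal {f : Q → ℝ} (hf : ContMDiff (𝓡 n) 𝓘(ℝ, ℝ) ∞ f) :
    ContMDiff (𝓡 n) 𝓘(ℝ, ℂ) ∞ fun x => (f x : ℂ) :=
  Complex.ofRealCLM.contDiff.contMDiff.comp hf

theorem smoothSection_frame_mem (f : testFunctions n Q) {x₀ : Q} {h : Q → ℂ}
    (hf : tsupport f.1 ⊆ (trivializationAt ℂ E x₀).baseSet)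
    (hh : ContMDiffOn (𝓡 n) 𝓘(ℝ, ℂ) ∞ h (trivializationAt ℂ E x₀).baseSet) :
    (fun x => (f.1 x • h x) • (trivializationAt ℂ E x₀).symm x (1 : ℂ)) ∈
      smoothCompactSections n E := by
  refine ⟨fun x => ?_, tsupport f.1, f.2.2, fun x hx => by
    simp only [image_eq_zero_of_notMem_tsupport hx, zero_smul]⟩
  by_cases hx : x ∈ tsupport f.1
  · rw [(trivializationAt ℂ E x₀).contMDiffAt_section_iff (hf hx)]
    have hxn := (trivializationAt ℂ E x₀).open_baseSet.mem_nhds (hf hx)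
    refine ((f.2.1 x).smul (hh.contMDiffAt hxn)).congr_of_eventuallyEq ?_
    filter_upwards [hxn] with y hy
    rw [((trivializationAt ℂ E x₀).linear ℂ hy).map_smul,
      (trivializationAt ℂ E x₀).apply_mk_symm hy, smul_eq_mul, mul_one]
    rfl
  · refine ((0 : smoothCompactSections n E).2.1 x).congr_of_eventuallyEq ?_
    filter_upwards [(isClosed_tsupport f.1).isOpen_compl.mem_nhds hx] with y hy
    rw [image_eq_zero_of_notMem_tsupport hy, zero_smul, zero_smul]
    rfl

theorem contMDiff_norm_sq (hE : IsSmoothHermitian n E) (σ : smoothCompactSections n E) :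
    ContMDiff (𝓡 n) 𝓘(ℝ, ℝ) ∞ fun x => ‖σ.1 x‖ ^ 2 := fun x => by
  have hx := (trivializationAt ℂ E x).open_baseSet.mem_nhds
    (FiberBundle.mem_baseSet_trivializationAt ℂ E x)
  have h1 := (smoothSection_contMDiffOn_trivialization σ x).contMDiffAt hx
  have h2 : ContMDiffAt (𝓡 n) 𝓘(ℝ, ℝ) ∞
      (fun y => ‖(trivializationAt ℂ E x ⟨y, σ.1 y⟩).2‖ ^ 2) x :=
    (contDiff_norm_sq ℝ (E := ℂ)).contMDiff.contMDiffAt.comp x h1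
  refine (h2.mul ((hE x).contMDiffAt hx)).congr_of_eventuallyEq ?_
  filter_upwards [hx] with y hy
  change _ = ‖(trivializationAt ℂ E x ⟨y, σ.1 y⟩).2‖ ^ 2 *
    ‖(trivializationAt ℂ E x).symm y (1 : ℂ)‖ ^ 2
  rw [← mul_pow, ← norm_smul, ← eq_trivialization_smul_frame hy]

theorem contMDiff_inner (hE : IsSmoothHermitian n E) (σ τ : smoothCompactSections n E) :
    ContMDiff (𝓡 n) 𝓘(ℝ, ℂ) ∞ fun x => (inner ℂ (σ.1 x) (τ.1 x) : ℂ) := by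
  have h := fun ρ : smoothCompactSections n E => contMDiff_ofReal (contMDiff_norm_sq hE ρ)
  have h1 := (((h (σ + τ)).sub (h (σ - τ))).add (((h (σ - Complex.I • τ)).sub
    (h (σ + Complex.I • τ))).complex_mul (contMDiff_const (c := Complex.I)))).complex_mul
    (contMDiff_const (c := (4 : ℂ)⁻¹))
  refine h1.congr fun x => ?_
  rw [inner_eq_sum_norm_sq_div_four]
  simp [div_eq_mul_inv]

theorem hasCompactSupport_inner [T2Space Q] (σ τ : smoothCompactSections n E) :
    HasCompactSupport fun x => (inner ℂ (σ.1 x) (τ.1 x) : ℂ) := by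
  obtain ⟨-, K, hK, hσ⟩ := σ.2
  exact HasCompactSupport.intro hK fun x hx => by rw [hσ x hx, inner_zero_left]

/-- The real and imaginary parts of the pointwise inner product, as test functions. -/
noncomputable def innerRe [T2Space Q] (hE : IsSmoothHermitian n E)
    (σ τ : smoothCompactSections n E) : testFunctions n Q :=
  ⟨fun x => (inner ℂ (σ.1 x) (τ.1 x) : ℂ).re,
    Complex.reCLM.contDiff.contMDiff.comp (contMDiff_inner hE σ τ),
    (hasCompactSupport_inner σ τ).comp_left (g := Complex.re) rfl⟩

noncomputable def innerIm [T2Space Q] (hE : IsSmoothHermitian n E)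
    (σ τ : smoothCompactSections n E) : testFunctions n Q :=
  ⟨fun x => (inner ℂ (σ.1 x) (τ.1 x) : ℂ).im,
    Complex.imCLM.contDiff.contMDiff.comp (contMDiff_inner hE σ τ),
    (hasCompactSupport_inner σ τ).comp_left (g := Complex.im) rfl⟩

section SquareIntegrable

variable [T2Space Q] [SecondCountableTopology Q] [MeasurableSpace Q] [BorelSpace Q]
  {μ : Measure Q}

theorem smoothSection_mem_squareIntegrable (hE : IsSmoothHermitian n E)
    (hμ : IsSmoothDensity n μ) (σ : smoothCompactSections n E) :
    σ.1 ∈ squareIntegrable hE μ := by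
  have := hμ.isLocallyFiniteMeasure
  have hm : IsMeasurableSection σ.1 := fun x₀ =>
    (continuousOn_iff_continuous_domRestrict.1
      (smoothSection_contMDiffOn_trivialization σ x₀).continuousOn).measurable
  refine ⟨hm, (memLp_two_iff_integrable_sq (hm.norm hE).aestronglyMeasurable).2 ?_⟩
  refine (contMDiff_norm_sq hE σ).continuous.integrable_of_hasCompactSupport ?_
  obtain ⟨-, K, hK, hσ⟩ := σ.2
  exact HasCompactSupport.intro hK fun x hx => by simp [hσ x hx]

/-- Smooth compactly supported sections are square-integrable. -/
def smoothToSquareIntegrable (hE : IsSmoothHermitian n E) (hμ : IsSmoothDensity n μ) :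
    smoothCompactSections n E →ₗ[ℂ] squareIntegrable hE μ where
  toFun σ := ⟨σ.1, smoothSection_mem_squareIntegrable hE hμ σ⟩
  map_add' _ _ := rfl
  map_smul' _ _ := rfl

end SquareIntegrable

variable [T2Space Q] [SecondCountableTopology Q] [IsManifold (𝓡 n) ∞ Q]

theorem exists_smoothSection_ne_zero (x : Q) : ∃ e : smoothCompactSections n E, e.1 x ≠ 0 := by
  have hx := FiberBundle.mem_baseSet_trivializationAt ℂ E x
  obtain ⟨f, hf1, hf2, -⟩ := exists_testFunction_eventuallyEq_one (n := n)
    ((trivializationAt ℂ E x).open_baseSet.mem_nhds hx)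
  refine ⟨⟨_, smoothSection_frame_mem f hf2 (contMDiffOn_const (c := (1 : ℂ)))⟩, ?_⟩
  change (f.1 x • (1 : ℂ)) • _ ≠ (0 : E x)
  rw [hf1.eq_of_nhds, Pi.one_apply, one_smul, one_smul]
  exact frame_ne_zero hx

/-- Countably many smooth sections have no common zero. -/
theorem exists_countable_smoothSections_ne_zero (hE : IsSmoothHermitian n E) :
    ∃ C : Set (smoothCompactSections n E), C.Countable ∧ ∀ x, ∃ e ∈ C, e.1 x ≠ 0 := by
  choose e he using exists_smoothSection_ne_zero (n := n) (E := E)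
  obtain ⟨S, hS, hcov⟩ := TopologicalSpace.countable_cover_nhds
    (f := fun x₀ : Q => {x | ‖(e x₀).1 x‖ ^ 2 ≠ 0})
    (fun x₀ => (isOpen_ne_fun (contMDiff_norm_sq hE (e x₀)).continuous continuous_const).mem_nhds
      (by simpa using he x₀))
  refine ⟨e '' S, hS.image e, fun x => ?_⟩
  have hx : x ∈ ⋃ x₀ ∈ S, {x | ‖(e x₀).1 x‖ ^ 2 ≠ 0} := by rw [hcov]; trivial
  simp only [mem_iUnion, exists_prop] at hx
  obtain ⟨x₀, h1, h2⟩ := hx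
  exact ⟨_, mem_image_of_mem e h1, by simpa using h2⟩

end SmoothSections

section TestIntegrals

variable {n : ℕ} {Q : Type*} [TopologicalSpace Q] [ChartedSpace (EuclideanSpace ℝ (Fin n)) Q]
  [T2Space Q] [SecondCountableTopology Q] [IsManifold (𝓡 n) ∞ Q] [MeasurableSpace Q]
  [BorelSpace Q] {μ : Measure Q}

theorem ae_eq_zero_of_integral_testFunction_smul_eq_zero {F : Type*} [NormedAddCommGroup F]
    [NormedSpace ℝ F] [CompleteSpace F] {g : Q → F} (hg : Integrable g μ)
    (h : ∀ f : testFunctions n Q, ∫ x, f.1 x • g x ∂μ = 0) : ∀ᵐ x ∂μ, g x = 0 :=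
  have := sigmaCompactSpace_of_chartedSpace_euclideanSpace n Q
  ae_eq_zero_of_integral_contMDiff_smul_eq_zero (𝓡 n) hg.locallyIntegrable
    fun f h1 h2 => h ⟨f, h1, h2⟩

theorem setIntegral_nonneg_of_forall_testFunction_sq {g : Q → ℝ} (hg : Integrable g μ)
    (h : ∀ f : testFunctions n Q, 0 ≤ ∫ x, f.1 x ^ 2 * g x ∂μ) {K : Set Q} (hK : IsCompact K) :
    0 ≤ ∫ x in K, g x ∂μ := by
  have := ChartedSpace.locallyCompactSpace (EuclideanSpace ℝ (Fin n)) Q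
  refine le_of_forall_pos_le_add fun ε hε => ?_
  have hfin : IsFiniteMeasure (μ.withDensity fun x => ‖g x‖ₑ) := isFiniteMeasure_withDensity hg.2.ne
  obtain ⟨U, hKU, hU, hUε⟩ := hK.measurableSet.exists_isOpen_sdiff_lt
    (μ := μ.withDensity fun x => ‖g x‖ₑ) (measure_ne_top _ _)
    (ENNReal.ofReal_pos.2 hε).ne'
  rw [withDensity_apply _ (hU.measurableSet.diff hK.measurableSet)] at hUε
  have hUn : ∫ x in U \ K, ‖g x‖ ∂μ ≤ ε := by
    rw [integral_norm_eq_lintegral_enorm hg.1.restrict]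
    exact ENNReal.toReal_le_of_le_ofReal hε.le hUε.2.le
  obtain ⟨f, hf1, hf2, hf3⟩ := exists_testFunction_eq_one_nhds (n := n) hK hU hKU
  have hfK : ∀ x ∈ K, f.1 x = 1 := fun x hx => hf1.self_of_nhdsSet x hx
  have hint : Integrable (fun x => f.1 x ^ 2 * g x) μ := by
    refine hg.bdd_mul (c := 1) (f.2.1.continuous.pow 2).aestronglyMeasurable (ae_of_all _ fun x => ?_)
    rw [norm_pow, Real.norm_of_nonneg (hf3 x).1]
    exact pow_le_one₀ (hf3 x).1 (hf3 x).2
  have h1 : ∫ x, f.1 x ^ 2 * g x ∂μ = (∫ x in K, g x ∂μ) + ∫ x in U \ K, f.1 x ^ 2 * g x ∂μ := by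
    rw [← setIntegral_eq_integral_of_forall_compl_eq_zero (s := U) fun x hx => by
      rw [image_eq_zero_of_notMem_tsupport fun h' => hx (hf2 h'), zero_pow two_ne_zero, zero_mul],
      ← union_sdiff_cancel hKU, setIntegral_union disjoint_sdiff_self_right
        (hU.measurableSet.diff hK.measurableSet) hint.integrableOn hint.integrableOn,
      union_sdiff_cancel hKU]
    congr 1
    exact setIntegral_congr_fun hK.measurableSet fun x hx => by
      simp only [hfK x hx, one_pow, one_mul]
  have h2 : ∫ x in U \ K, f.1 x ^ 2 * g x ∂μ ≤ ∫ x in U \ K, ‖g x‖ ∂μ := by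
    refine integral_mono hint.integrableOn hg.norm.integrableOn fun x => ?_
    have h3 : f.1 x ^ 2 ≤ 1 := pow_le_one₀ (hf3 x).1 (hf3 x).2
    calc f.1 x ^ 2 * g x ≤ f.1 x ^ 2 * ‖g x‖ :=
          mul_le_mul_of_nonneg_left (Real.le_norm_self _) (sq_nonneg _)
      _ ≤ 1 * ‖g x‖ := mul_le_mul_of_nonneg_right h3 (norm_nonneg _)
      _ = ‖g x‖ := one_mul _
  linarith [h f]

theorem ae_nonneg_of_forall_testFunction_sq {g : Q → ℝ} (hg : Integrable g μ)
    (h : ∀ f : testFunctions n Q, 0 ≤ ∫ x, f.1 x ^ 2 * g x ∂μ) : ∀ᵐ x ∂μ, 0 ≤ g x := by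
  have := ChartedSpace.locallyCompactSpace (EuclideanSpace ℝ (Fin n)) Q
  have hfin : IsFiniteMeasure (μ.withDensity fun x => ‖g x‖ₑ) := isFiniteMeasure_withDensity hg.2.ne
  have := sigmaCompactSpace_of_chartedSpace_euclideanSpace n Q
  obtain ⟨g', hg', hgg'⟩ := hg.1
  have hi : Integrable g' μ := hg.congr hgg'
  have hen : ∀ s, ∫⁻ x in s, ‖g x‖ₑ ∂μ = ∫⁻ x in s, ‖g' x‖ₑ ∂μ := fun s =>
    lintegral_congr_ae (ae_restrict_of_ae (hgg'.mono fun x hx => by simp only [hx]))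
  suffices hs : μ {x | g' x < 0} = 0 by
    have h0 : ∀ᵐ x ∂μ, ¬ g' x < 0 := by rw [ae_iff]; simpa using hs
    filter_upwards [h0, hgg'] with x h1 h2
    rw [h2]
    exact not_lt.1 h1
  have hm : MeasurableSet {x | g' x < 0} := hg'.measurable measurableSet_Iio
  have hK0 : ∀ K ⊆ {x | g' x < 0}, IsCompact K → (μ.withDensity fun x => ‖g x‖ₑ) K = 0 := by
    intro K hKs hK
    have h1 := setIntegral_nonneg_of_forall_testFunction_sq hg h hK
    rw [integral_congr_ae (ae_restrict_of_ae hgg')] at h1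
    have h2 : ∫ x in K, ‖g' x‖ ∂μ = -∫ x in K, g' x ∂μ := by
      rw [← integral_neg]
      exact setIntegral_congr_fun hK.measurableSet fun x hx => Real.norm_of_nonpos (hKs hx).le
    have h3 : ∫ x in K, ‖g' x‖ ∂μ = 0 :=
      le_antisymm (by linarith) (integral_nonneg fun _ => norm_nonneg _)
    rw [integral_norm_eq_lintegral_enorm hi.1.restrict, ENNReal.toReal_eq_zero_iff] at h3
    rw [withDensity_apply _ hK.measurableSet, hen]
    exact h3.resolve_right hi.integrableOn.2.ne
  have h4 : (μ.withDensity fun x => ‖g x‖ₑ) {x | g' x < 0} = 0 := by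
    rw [hm.measure_eq_iSup_isCompact_of_ne_top (measure_ne_top _ _)]
    simp only [ENNReal.iSup_eq_zero]
    exact hK0
  rw [withDensity_apply _ hm, hen,
    lintegral_eq_zero_iff hg'.measurable.enorm] at h4
  have h5 : ∀ᵐ x ∂(μ.restrict {x | g' x < 0}), False := by
    filter_upwards [h4, ae_restrict_mem hm] with x h6 h7
    exact h7.ne (by simpa using h6)
  rw [ae_iff] at h5
  simpa using h5

end TestIntegrals

section MultiplicationOperators

variable {n : ℕ} {Q : Type*} [TopologicalSpace Q] [ChartedSpace (EuclideanSpace ℝ (Fin n)) Q]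
  [SecondCountableTopology Q] [MeasurableSpace Q]
  [BorelSpace Q] {μ : Measure Q}
  {E : Q → Type*} [∀ x, NormedAddCommGroup (E x)] [∀ x, InnerProductSpace ℂ (E x)]
  [TopologicalSpace (TotalSpace ℂ E)] [FiberBundle ℂ E] [VectorBundle ℂ ℂ E]
  {hE : IsSmoothHermitian n E}

theorem squareIntegrable_integrable_inner (σ τ : squareIntegrable hE μ) :
    Integrable (fun x => (inner ℂ (σ.1 x) (τ.1 x) : ℂ)) μ := by
  have hm : Measurable fun x => (inner ℂ (σ.1 x) (τ.1 x) : ℂ) := by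
    have h := fun ρ : squareIntegrable hE μ =>
      (Complex.measurable_ofReal.comp (ρ.2.1.norm hE)).pow_const 2
    have h1 := (((h (σ + τ)).sub (h (σ - τ))).add (((h (σ - Complex.I • τ)).sub
      (h (σ + Complex.I • τ))).mul_const Complex.I)).div_const 4
    convert h1 using 2 with x
    exact inner_eq_sum_norm_sq_div_four _ _
  refine (σ.2.2.integrable_mul τ.2.2).mono hm.aestronglyMeasurable (ae_of_all _ fun x => ?_)
  rw [Pi.mul_apply, norm_mul, norm_norm, norm_norm]
  exact norm_inner_le_norm _ _

variable {𝒜 : NonUnitalSubalgebra ℝ (Q → ℝ)} {h𝒜 : 𝒜 ≤ smoothZeroAtInfty n Q}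
  {H : Type*} [NormedAddCommGroup H] [InnerProductSpace ℂ H]
  (S : LocalizableFamily hE μ 𝒜 h𝒜 H) (t : ℝ)

namespace LocalizableFamily

theorem inner_rep_loc (a : 𝒜) (σ τ : squareIntegrable hE μ) :
    inner ℂ (S.loc t σ) (S.rep t a (S.loc t τ)) =
      ∫ x, a.1 x • (inner ℂ (σ.1 x) (τ.1 x) : ℂ) ∂μ := by
  rw [S.rep_loc, S.inner_loc]
  refine integral_congr_ae (ae_of_all _ fun x => ?_)
  simp only [mulSection, inner_smul_right, Complex.real_smul]

theorem inner_rep_left (a : 𝒜) (ψ φ : H) :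
    inner ℂ (S.rep t a ψ) φ = inner ℂ ψ (S.rep t a φ) := by
  obtain ⟨σ, rfl⟩ := S.loc_surjective t ψ
  obtain ⟨τ, rfl⟩ := S.loc_surjective t φ
  rw [S.rep_loc, S.rep_loc, S.inner_loc, S.inner_loc]
  refine integral_congr_ae (ae_of_all _ fun x => ?_)
  simp only [mulSection, inner_smul_right, inner_smul_left, Complex.conj_ofReal]

theorem rep_commute (a b : 𝒜) : S.rep t a * S.rep t b = S.rep t b * S.rep t a := by
  have : a * b = b * a := Subtype.ext (mul_comm _ _)
  rw [← map_mul, this, map_mul]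

theorem rep_isPositive {a : 𝒜} (ha : ∀ x, 0 ≤ a.1 x) : (S.rep t a).IsPositive := by
  refine ⟨fun ψ φ => S.inner_rep_left t a ψ φ, fun ψ => ?_⟩
  obtain ⟨σ, rfl⟩ := S.loc_surjective t ψ
  rw [ContinuousLinearMap.reApplyInnerSelf_apply, S.inner_rep_left, S.inner_rep_loc]
  change 0 ≤ (∫ x, a.1 x • (inner ℂ (σ.1 x) (σ.1 x) : ℂ) ∂μ).re
  have h : ∀ x, a.1 x • (inner ℂ (σ.1 x) (σ.1 x) : ℂ) = ((a.1 x * ‖σ.1 x‖ ^ 2 : ℝ) : ℂ) :=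
    fun x => by
      rw [inner_self_eq_norm_sq_to_K, Complex.real_smul]
      push_cast
      rfl
  simp only [h]
  rw [integral_complex_ofReal, Complex.ofReal_re]
  exact integral_nonneg fun x => mul_nonneg (ha x) (sq_nonneg _)

theorem loc_eq_zero_of_ae {σ : squareIntegrable hE μ} (h : ∀ᵐ x ∂μ, σ.1 x = 0) :
    S.loc t σ = 0 := by
  rw [← inner_self_eq_zero (𝕜 := ℂ), S.inner_loc]
  refine integral_eq_zero_of_ae ?_
  filter_upwards [h] with x hx
  rw [hx, inner_zero_left]
  rfl

end LocalizableFamily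

end MultiplicationOperators

section Commutant

theorem complex_re_integral {α : Type*} [MeasurableSpace α] {μ : Measure α} {g : α → ℂ}
    (hg : Integrable g μ) : (∫ x, g x ∂μ).re = ∫ x, (g x).re ∂μ :=
  (integral_re hg).symm

variable {n : ℕ} {Q : Type*} [TopologicalSpace Q] [ChartedSpace (EuclideanSpace ℝ (Fin n)) Q]
  [SecondCountableTopology Q] [MeasurableSpace Q]
  [BorelSpace Q] {μ : Measure Q}
  {E : Q → Type*} [∀ x, NormedAddCommGroup (E x)] [∀ x, InnerProductSpace ℂ (E x)]
  [TopologicalSpace (TotalSpace ℂ E)] [FiberBundle ℂ E] [VectorBundle ℂ ℂ E]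
  {hE : IsSmoothHermitian n E} {𝒜 : NonUnitalSubalgebra ℝ (Q → ℝ)}
  {h𝒜 : 𝒜 ≤ smoothZeroAtInfty n Q}
  {H : Type*} [NormedAddCommGroup H] [InnerProductSpace ℂ H]

namespace LocalizableFamily

variable (S : LocalizableFamily hE μ 𝒜 h𝒜 H) (t : ℝ)

theorem isClosed_commutant_isSymmetric {M : Set (H →L[ℂ] H)} :
    strongClosure {T : H →L[ℂ] H | (∀ ψ φ, inner ℂ (T ψ) φ = inner ℂ ψ (T φ)) ∧
        ∀ A ∈ M, ∀ ψ, T (A ψ) = A (T ψ)} ⊆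
      {T : H →L[ℂ] H | (∀ ψ φ, inner ℂ (T ψ) φ = inner ℂ ψ (T φ)) ∧
        ∀ A ∈ M, ∀ ψ, T (A ψ) = A (T ψ)} := by
  intro T hT
  have hev : ∀ ψ : H, Continuous fun p : H →Lₚₜ[ℂ] H => p ψ := fun ψ => continuous_eval_const ψ
  refine closure_minimal (t := {p : H →Lₚₜ[ℂ] H | (∀ ψ φ, inner ℂ (p ψ) φ = inner ℂ ψ (p φ)) ∧
        ∀ A ∈ M, ∀ ψ, p (A ψ) = A (p ψ)}) ?_ ?_ hT
  · rintro _ ⟨A, hA, rfl⟩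
    exact hA
  · simp only [ofPred_and, ofPred_forall]
    refine IsClosed.inter (isClosed_iInter fun ψ => isClosed_iInter fun φ => ?_)
      (isClosed_iInter fun A => isClosed_iInter fun _ => isClosed_iInter fun ψ => ?_)
    · exact isClosed_eq ((hev ψ).inner continuous_const) (continuous_const.inner (hev φ))
    · exact isClosed_eq (hev _) (A.continuous.comp (hev ψ))

theorem isClosed_nonneg :
    strongClosure {T : H →L[ℂ] H | ∀ ψ, 0 ≤ (inner ℂ (T ψ) ψ).re} ⊆
      {T : H →L[ℂ] H | ∀ ψ, 0 ≤ (inner ℂ (T ψ) ψ).re} := by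
  intro T hT
  have hev : ∀ ψ : H, Continuous fun p : H →Lₚₜ[ℂ] H => p ψ := fun ψ => continuous_eval_const ψ
  refine closure_minimal (t := {p : H →Lₚₜ[ℂ] H | ∀ ψ, 0 ≤ (inner ℂ (p ψ) ψ).re}) ?_ ?_ hT
  · rintro _ ⟨A, hA, rfl⟩
    exact hA
  · simp only [ofPred_forall]
    exact isClosed_iInter fun ψ => isClosed_le continuous_const
      (Complex.continuous_re.comp ((hev ψ).inner continuous_const))

theorem mem_strongClosure_of_forall_finset {M : Set (H →L[ℂ] H)} {T : H →L[ℂ] H}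
    (h : ∀ (s : Finset H) (ε : ℝ), 0 < ε → ∃ A ∈ M, ∀ ψ ∈ s, ‖A ψ - T ψ‖ < ε) :
    T ∈ strongClosure M := by
  refine (mem_closure_iff_nhds_basis
    ((PointwiseConvergenceCLM.withSeminorms (σ := RingHom.id ℂ) (E := H) (F := H)).hasBasis_ball
      (x := ContinuousLinearMap.toPointwiseConvergenceCLM ℂ (RingHom.id ℂ) H H T))).2 ?_
  rintro ⟨s, ε⟩ hε
  obtain ⟨A, hA, hAT⟩ := h s ε hε
  refine ⟨_, mem_image_of_mem _ hA, ?_⟩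
  rw [Seminorm.mem_ball]
  exact Seminorm.finset_sup_apply_lt hε fun ψ hψ => hAT ψ hψ

/-- A convex cone of operators is strongly dense at `T` if every functional
`A ↦ Re ∑ ⟪φ_i, A ψ_i⟫` that is nonnegative on the cone is nonnegative at `T`. -/
theorem mem_strongClosure_of_forall_re_sum_inner_nonneg [CompleteSpace H]
    {M : Set (H →L[ℂ] H)} {T : H →L[ℂ] H}
    (h0 : 0 ∈ M) (hadd : ∀ A ∈ M, ∀ B ∈ M, A + B ∈ M)
    (hsmul : ∀ r : ℝ, 0 ≤ r → ∀ A ∈ M, (r : ℂ) • A ∈ M)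
    (h : ∀ (s : Finset H) (φ : s → H),
      (∀ A ∈ M, 0 ≤ (∑ i : s, inner ℂ (φ i) (A i)).re) →
        0 ≤ (∑ i : s, inner ℂ (φ i) (T i)).re) :
    T ∈ strongClosure M := by
  refine mem_strongClosure_of_forall_finset fun s ε hε => ?_
  let Φ : (H →L[ℂ] H) → PiLp 2 fun _ : s => H := fun A => WithLp.toLp 2 fun i => A i
  have hconv : Convex ℝ (Φ '' M) := by
    rintro _ ⟨A, hA, rfl⟩ _ ⟨B, hB, rfl⟩ a b ha hb -
    refine ⟨(a : ℂ) • A + (b : ℂ) • B, hadd _ (hsmul a ha A hA) _ (hsmul b hb B hB), ?_⟩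
    ext i
    simp [Φ]
  have hmem : Φ T ∈ closure (Φ '' M) := by
    by_contra hT
    obtain ⟨f, u, hf, hfT⟩ := RCLike.geometric_hahn_banach_closed_point (𝕜 := ℂ)
      hconv.closure isClosed_closure hT
    obtain ⟨y, rfl⟩ := (InnerProductSpace.toDual ℂ (PiLp 2 fun _ : s => H)).surjective f
    have hy : ∀ A : H →L[ℂ] H,
        RCLike.re (InnerProductSpace.toDual ℂ (PiLp 2 fun _ : s => H) y (Φ A)) =
          (∑ i : s, inner ℂ (y i) (A i)).re := fun A => by
      rw [InnerProductSpace.toDual_apply_apply, PiLp.inner_apply]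
      rfl
    have hu : ∀ A ∈ M, (∑ i : s, inner ℂ (y i) (A i)).re < u := fun A hA => by
      rw [← hy]
      exact hf _ (subset_closure (mem_image_of_mem _ hA))
    have hu0 : 0 < u := by simpa using hu 0 h0
    have hneg : ∀ A ∈ M, (∑ i : s, inner ℂ (y i) (A i)).re ≤ 0 := fun A hA => by
      by_contra! hpos
      have h1 := hu _ (hsmul (u / (∑ i : s, inner ℂ (y i) (A i)).re) (by positivity) A hA)
      simp only [smul_apply, inner_smul_right] at h1
      rw [← Finset.mul_sum, Complex.re_ofReal_mul, div_mul_cancel₀ _ hpos.ne'] at h1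
      exact lt_irrefl _ h1
    have h2 := h s (fun i => -y i) fun A hA => by
      simpa only [inner_neg_left, Finset.sum_neg_distrib, Complex.neg_re, neg_nonneg] using hneg A hA
    simp only [inner_neg_left, Finset.sum_neg_distrib, Complex.neg_re, neg_nonneg] at h2
    rw [hy] at hfT
    linarith
  obtain ⟨_, ⟨A, hA, rfl⟩, hd⟩ := Metric.mem_closure_iff.1 hmem ε hε
  refine ⟨A, hA, fun ψ hψ => ?_⟩
  have h3 := PiLp.norm_apply_le (Φ A - Φ T) (⟨ψ, hψ⟩ : s)
  rw [dist_comm, dist_eq_norm] at hd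
  exact h3.trans_lt hd

section Decomposable

variable [T2Space Q] [IsManifold (𝓡 n) ∞ Q] (ht : testFunctions n Q ≤ 𝒜) {T : H →L[ℂ] H}

include ht in
theorem ae_inner_comm_of_commute (hT : ∀ ψ φ, inner ℂ (T ψ) φ = inner ℂ ψ (T φ))
    (hTc : ∀ a ψ, T (S.rep t a ψ) = S.rep t a (T ψ)) {σ σ' τ τ' : squareIntegrable hE μ}
    (hσ : S.loc t σ' = T (S.loc t σ)) (hτ : S.loc t τ' = T (S.loc t τ)) :
    ∀ᵐ x ∂μ, (inner ℂ (σ'.1 x) (τ.1 x) : ℂ) = inner ℂ (σ.1 x) (τ'.1 x) := by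
  have h : ∀ᵐ x ∂μ, (inner ℂ (σ'.1 x) (τ.1 x) : ℂ) - inner ℂ (σ.1 x) (τ'.1 x) = 0 := by
    refine ae_eq_zero_of_integral_testFunction_smul_eq_zero (n := n)
      ((squareIntegrable_integrable_inner σ' τ).sub (squareIntegrable_integrable_inner σ τ'))
      fun f => ?_
    have hf : f.1 ∈ 𝒜 := ht f.2
    have h1 := S.inner_rep_loc t ⟨f.1, hf⟩ σ' τ
    have h2 := S.inner_rep_loc t ⟨f.1, hf⟩ σ τ'
    rw [hσ, hT, hTc] at h1
    rw [hτ] at h2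
    have hi : ∀ α β : squareIntegrable hE μ,
        Integrable (fun x => f.1 x • (inner ℂ (α.1 x) (β.1 x) : ℂ)) μ := fun α β => by
      have := squareIntegrable_integrable_inner α (mulSection hE μ f.1 (h𝒜 hf) β)
      simpa only [mulSection, inner_smul_right, Complex.real_smul] using this
    simp only [smul_sub]
    rw [integral_sub (hi _ _) (hi _ _), ← h1, ← h2, sub_self]
  filter_upwards [h] with x hx using sub_eq_zero.1 hx

include ht in
/-- An operator commuting with the multiplication operators acts by a real factor, the same for all
sections, wherever a given section does not vanish. -/
theorem ae_eq_smul_of_commute (hT : ∀ ψ φ, inner ℂ (T ψ) φ = inner ℂ ψ (T φ))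
    (hTc : ∀ a ψ, T (S.rep t a ψ) = S.rep t a (T ψ)) {e e' σ σ' : squareIntegrable hE μ}
    (he : S.loc t e' = T (S.loc t e)) (hσ : S.loc t σ' = T (S.loc t σ)) :
    ∀ᵐ x ∂μ, e.1 x ≠ 0 →
      σ'.1 x = (((inner ℂ (e.1 x) (e'.1 x) : ℂ).re / ‖e.1 x‖ ^ 2 : ℝ) : ℂ) • σ.1 x := by
  filter_upwards [S.ae_inner_comm_of_commute t ht hT hTc he he,
    S.ae_inner_comm_of_commute t ht hT hTc hσ he] with x h1 h2 hx
  have hre : (inner ℂ (e.1 x) (e'.1 x) : ℂ) = ((inner ℂ (e.1 x) (e'.1 x) : ℂ).re : ℂ) := by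
    refine (Complex.conj_eq_iff_re.1 ?_).symm
    rw [inner_conj_symm, h1]
  set m : ℝ := (inner ℂ (e.1 x) (e'.1 x) : ℂ).re / ‖e.1 x‖ ^ 2
  have h3 : e'.1 x = (m : ℂ) • e.1 x := by
    have h4 := eq_inner_div_smul_of_ne_zero hx (e'.1 x)
    rw [hre] at h4
    rw [h4, Complex.ofReal_div]
  have h5 : inner ℂ (e.1 x) (σ'.1 x - (m : ℂ) • σ.1 x) = 0 := by
    rw [h3, inner_smul_right] at h2
    rw [inner_sub_right, inner_smul_right, ← inner_conj_symm (e.1 x) (σ'.1 x), h2, map_mul,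
      Complex.conj_ofReal, inner_conj_symm, sub_self]
  have h6 := eq_inner_div_smul_of_ne_zero hx (σ'.1 x - (m : ℂ) • σ.1 x)
  rw [h5, zero_div, zero_smul, sub_eq_zero] at h6
  exact h6

include ht in
theorem ae_re_inner_nonneg_of_commute (hT : ∀ ψ φ, inner ℂ (T ψ) φ = inner ℂ ψ (T φ))
    (hTc : ∀ a ψ, T (S.rep t a ψ) = S.rep t a (T ψ)) (hTp : ∀ ψ, 0 ≤ (inner ℂ (T ψ) ψ).re)
    {e e' : squareIntegrable hE μ} (he : S.loc t e' = T (S.loc t e)) :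
    ∀ᵐ x ∂μ, 0 ≤ (inner ℂ (e.1 x) (e'.1 x) : ℂ).re := by
  refine ae_nonneg_of_forall_testFunction_sq (n := n)
    (squareIntegrable_integrable_inner e e').re fun f => ?_
  have hf : f.1 ∈ 𝒜 := ht f.2
  have hi := squareIntegrable_integrable_inner (mulSection hE μ f.1 (h𝒜 hf) e)
    (mulSection hE μ f.1 (h𝒜 hf) e')
  have h1 := hTp (S.rep t ⟨f.1, hf⟩ (S.loc t e))
  rw [hT, hTc, ← he, S.rep_loc, S.rep_loc, S.inner_loc] at h1
  rw [complex_re_integral hi] at h1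
  refine h1.trans_eq (integral_congr_ae (ae_of_all _ fun x => ?_))
  simp only [mulSection, inner_smul_left, inner_smul_right, Complex.conj_ofReal]
  change ((f.1 x : ℂ) * ((f.1 x : ℂ) * _)).re = _
  rw [Complex.re_ofReal_mul, Complex.re_ofReal_mul, ← mul_assoc, ← sq]

variable [VectorBundle ℝ ℂ E] [ContMDiffVectorBundle ∞ ℂ E (𝓡 n)]

include ht in
theorem re_sum_inner_nonneg_of_commute (hμ : IsSmoothDensity n μ)
    (hT : ∀ ψ φ, inner ℂ (T ψ) φ = inner ℂ ψ (T φ))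
    (hTc : ∀ a ψ, T (S.rep t a ψ) = S.rep t a (T ψ)) (hTp : ∀ ψ, 0 ≤ (inner ℂ (T ψ) ψ).re)
    {ι : Type*} [Fintype ι] (φ ψ : ι → H)
    (h : ∀ a : 𝒜, (∀ x, 0 ≤ a.1 x) → 0 ≤ (∑ i, inner ℂ (φ i) (S.rep t a (ψ i))).re) :
    0 ≤ (∑ i, inner ℂ (φ i) (T (ψ i))).re := by
  choose lift hlift using S.loc_surjective t
  have hint := fun i => squareIntegrable_integrable_inner (lift (φ i)) (lift (ψ i))
  have hintT := fun i => squareIntegrable_integrable_inner (lift (φ i)) (lift (T (ψ i)))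
  have hg : ∀ᵐ x ∂μ, 0 ≤ (∑ i, (inner ℂ ((lift (φ i)).1 x) ((lift (ψ i)).1 x) : ℂ)).re := by
    refine ae_nonneg_of_forall_testFunction_sq (n := n)
      (integrable_finsetSum _ fun i _ => hint i).re fun f => ?_
    have hf : (f * f).1 ∈ 𝒜 := ht (f * f).2
    have h1 := h ⟨_, hf⟩ fun x => mul_self_nonneg _
    have h2 : ∀ i, inner ℂ (φ i) (S.rep t ⟨_, hf⟩ (ψ i)) =
        ∫ x, (f * f).1 x • (inner ℂ ((lift (φ i)).1 x) ((lift (ψ i)).1 x) : ℂ) ∂μ := fun i => by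
      rw [← S.inner_rep_loc t ⟨_, hf⟩, hlift, hlift]
    have hi : ∀ i, Integrable (fun x =>
        (f * f).1 x • (inner ℂ ((lift (φ i)).1 x) ((lift (ψ i)).1 x) : ℂ)) μ := fun i => by
      have := squareIntegrable_integrable_inner (lift (φ i))
        (mulSection hE μ (f * f).1 (h𝒜 hf) (lift (ψ i)))
      simpa only [mulSection, inner_smul_right, Complex.real_smul] using this
    rw [Finset.sum_congr rfl fun i _ => h2 i, ← integral_finsetSum _ fun i _ => hi i] at h1
    rw [complex_re_integral (integrable_finsetSum _ fun i _ => hi i)] at h1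
    refine h1.trans_eq (integral_congr_ae (ae_of_all _ fun x => ?_))
    simp only
    rw [← Finset.smul_sum]
    change ((f.1 x * f.1 x) • _ : ℂ).re = f.1 x ^ 2 * Complex.re _
    rw [Complex.smul_re, smul_eq_mul, sq]
  obtain ⟨C, hC, hCx⟩ := exists_countable_smoothSections_ne_zero hE
  let L := smoothToSquareIntegrable hE hμ
  have h3 : ∀ᵐ x ∂μ, ∀ e ∈ C, 0 ≤ (inner ℂ ((L e).1 x) ((lift (T (S.loc t (L e)))).1 x) : ℂ).re :=
    (ae_ball_iff hC).2 fun e _ => S.ae_re_inner_nonneg_of_commute t ht hT hTc hTp (hlift _)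
  have h4 : ∀ᵐ x ∂μ, ∀ e ∈ C, ∀ i, (L e).1 x ≠ 0 → (lift (T (ψ i))).1 x =
      (((inner ℂ ((L e).1 x) ((lift (T (S.loc t (L e)))).1 x) : ℂ).re / ‖(L e).1 x‖ ^ 2 : ℝ) : ℂ) •
        (lift (ψ i)).1 x :=
    (ae_ball_iff hC).2 fun e _ => ae_all_iff.2 fun i =>
      S.ae_eq_smul_of_commute t ht hT hTc (hlift _) (by rw [hlift, hlift])
  have h5 : ∀ i, inner ℂ (φ i) (T (ψ i)) =
      ∫ x, (inner ℂ ((lift (φ i)).1 x) ((lift (T (ψ i))).1 x) : ℂ) ∂μ := fun i => by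
    rw [← S.inner_loc t, hlift, hlift]
  rw [Finset.sum_congr rfl fun i _ => h5 i, ← integral_finsetSum _ fun i _ => hintT i]
  rw [complex_re_integral (integrable_finsetSum _ fun i _ => hintT i)]
  refine integral_nonneg_of_ae ?_
  filter_upwards [hg, h3, h4] with x hgx h3x h4x
  obtain ⟨e, he, hex⟩ := hCx x
  simp only [h4x e he _ hex, inner_smul_right]
  rw [← Finset.mul_sum]
  change 0 ≤ Complex.re _
  rw [Complex.re_ofReal_mul]
  exact mul_nonneg (div_nonneg (h3x e he) (sq_nonneg _)) hgx

end Decomposable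

end LocalizableFamily

end Commutant

section StrongClosure

variable {n : ℕ} {Q : Type*} [TopologicalSpace Q] [ChartedSpace (EuclideanSpace ℝ (Fin n)) Q]
  [SecondCountableTopology Q] [MeasurableSpace Q]
  [BorelSpace Q] {μ : Measure Q}
  {E : Q → Type*} [∀ x, NormedAddCommGroup (E x)] [∀ x, InnerProductSpace ℂ (E x)]
  [TopologicalSpace (TotalSpace ℂ E)] [FiberBundle ℂ E] [VectorBundle ℂ ℂ E]
  {hE : IsSmoothHermitian n E} {𝒜 : NonUnitalSubalgebra ℝ (Q → ℝ)}
  {h𝒜 : 𝒜 ≤ smoothZeroAtInfty n Q}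
  {H : Type*} [NormedAddCommGroup H] [InnerProductSpace ℂ H]
  [T2Space Q] [VectorBundle ℝ ℂ E] [ContMDiffVectorBundle ∞ ℂ E (𝓡 n)]

namespace LocalizableFamily

variable (S : LocalizableFamily hE μ 𝒜 h𝒜 H) (t : ℝ)

/-- The smooth vectors, as the image of the smooth compactly supported sections. -/
noncomputable def smoothLoc (hμ : IsSmoothDensity n μ) : smoothCompactSections n E →ₗ[ℂ] H :=
  S.loc t ∘ₗ smoothToSquareIntegrable hE hμ

theorem coe_range_smoothLoc (hμ : IsSmoothDensity n μ) :
    ((LinearMap.range (S.smoothLoc t hμ) : Submodule ℂ H) : Set H) = S.smoothVectors t := by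
  ext ψ
  constructor
  · rintro ⟨σ, rfl⟩
    exact ⟨smoothToSquareIntegrable hE hμ σ, σ.2, rfl⟩
  · rintro ⟨σ, hσ, rfl⟩
    exact ⟨⟨σ.1, hσ⟩, rfl⟩

theorem inner_smoothLoc (hμ : IsSmoothDensity n μ) (σ τ : smoothCompactSections n E) :
    inner ℂ (S.smoothLoc t hμ σ) (S.smoothLoc t hμ τ) =
      ∫ x, (inner ℂ (σ.1 x) (τ.1 x) : ℂ) ∂μ :=
  S.inner_loc t _ _

theorem smoothLoc_injective (hμ : IsSmoothDensity n μ) :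
    Function.Injective (S.smoothLoc t hμ) := by
  have := hμ.isOpenPosMeasure
  refine (injective_iff_map_eq_zero _).2 fun σ hσ => ?_
  have := hμ.isLocallyFiniteMeasure
  ext x
  by_contra hx
  have h1 := S.inner_smoothLoc t hμ σ σ
  have h2 : ∀ x, (inner ℂ (σ.1 x) (σ.1 x) : ℂ) = ((‖σ.1 x‖ ^ 2 : ℝ) : ℂ) := fun x => by
    rw [inner_self_eq_norm_sq_to_K]
    push_cast
    rfl
  have hc : HasCompactSupport fun x => ‖σ.1 x‖ ^ 2 := by
    obtain ⟨-, K, hK, hσ⟩ := σ.2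
    exact HasCompactSupport.intro hK fun x hx => by simp [hσ x hx]
  simp only [h2] at h1
  rw [hσ, inner_zero_left, integral_complex_ofReal, eq_comm, Complex.ofReal_eq_zero] at h1
  exact ((contMDiff_norm_sq hE σ).continuous.integral_pos_of_hasCompactSupport_nonneg_nonzero hc
    (fun _ => sq_nonneg _) (x := x) (by simpa using hx)).ne' h1

variable [IsManifold (𝓡 n) ∞ Q]

theorem mem_strongClosure_range_rep [CompleteSpace H] (hμ : IsSmoothDensity n μ)
    (ht : testFunctions n Q ≤ 𝒜) {T : H →L[ℂ] H}
    (hT : ∀ ψ φ, inner ℂ (T ψ) φ = inner ℂ ψ (T φ))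
    (hTc : ∀ a ψ, T (S.rep t a ψ) = S.rep t a (T ψ)) :
    T ∈ strongClosure (range (S.rep t)) := by
  have key : ∀ (c : ℝ) (T : H →L[ℂ] H), (∀ ψ φ, inner ℂ (T ψ) φ = inner ℂ ψ (T φ)) →
      (∀ a ψ, T (S.rep t a ψ) = S.rep t a (T ψ)) → ‖T‖ ≤ c → ∀ (s : Finset H) (φ : s → H),
      (∀ A ∈ range (S.rep t), 0 ≤ (∑ i : s, inner ℂ (φ i) (A i)).re) →
      0 ≤ (∑ i : s, inner ℂ (φ i) (T i)).re + c * (∑ i : s, inner ℂ (φ i) i.1).re := by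
    intro c T hT hTc hc s φ hφ
    have h1 := S.re_sum_inner_nonneg_of_commute t ht hμ
      (T := T + (c : ℂ) • ContinuousLinearMap.id ℂ H)
      (fun ψ φ => by
        simp only [add_apply, smul_apply, ContinuousLinearMap.id_apply, inner_add_left,
          inner_add_right, hT, inner_smul_left, inner_smul_right, Complex.conj_ofReal])
      (fun a ψ => by
        simp only [add_apply, smul_apply, ContinuousLinearMap.id_apply, hTc, map_add, map_smul])
      (fun ψ => by
        simp only [add_apply, smul_apply, ContinuousLinearMap.id_apply, inner_add_left,
          inner_smul_left, Complex.conj_ofReal, Complex.add_re, Complex.re_ofReal_mul]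
        have h2 : |(inner ℂ (T ψ) ψ : ℂ).re| ≤ c * (‖ψ‖ * ‖ψ‖) := by
          refine (Complex.abs_re_le_norm _).trans ((norm_inner_le_norm _ _).trans ?_)
          rw [← mul_assoc]
          exact mul_le_mul_of_nonneg_right (T.le_of_opNorm_le hc ψ) (norm_nonneg _)
        have h3 : (inner ℂ ψ ψ : ℂ).re = ‖ψ‖ * ‖ψ‖ := by
          have := inner_self_eq_norm_mul_norm (𝕜 := ℂ) ψ
          exact this
        rw [h3]
        linarith [neg_abs_le (inner ℂ (T ψ) ψ : ℂ).re])
      φ (fun i => i.1) fun a _ => hφ _ ⟨a, rfl⟩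
    simpa only [add_apply, smul_apply, ContinuousLinearMap.id_apply, inner_add_right,
      inner_smul_right, Finset.sum_add_distrib, ← Finset.mul_sum, Complex.add_re,
      Complex.re_ofReal_mul] using h1
  refine mem_strongClosure_of_forall_re_sum_inner_nonneg ⟨0, map_zero _⟩ ?_ ?_ fun s φ hφ => ?_
  · rintro _ ⟨a, rfl⟩ _ ⟨b, rfl⟩
    exact ⟨a + b, map_add _ _ _⟩
  · rintro r - _ ⟨a, rfl⟩
    exact ⟨r • a, by rw [map_smul]; ext ψ; simp⟩
  · have hneg : ∀ A ∈ range (S.rep t), 0 ≤ (∑ i : s, inner ℂ (-φ i) (A i)).re := by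
      rintro _ ⟨a, rfl⟩
      have := hφ _ ⟨-a, rfl⟩
      rw [map_neg] at this
      simpa only [neg_apply, inner_neg_right, inner_neg_left] using this
    have h1 := key ‖T‖ T hT hTc le_rfl s φ hφ
    have h2 := key ‖T‖ 0 (fun _ _ => by simp) (fun _ _ => by simp) (by simp) s _ hneg
    simp only [zero_apply, inner_zero_right, Finset.sum_const_zero, Complex.zero_re, zero_add,
      inner_neg_left, Finset.sum_neg_distrib, Complex.neg_re] at h2
    linarith

/-- The strong closure of the algebra of real multiplication operators is the self-adjoint part of
its commutant. -/
theorem strongClosure_range_rep [CompleteSpace H] (hμ : IsSmoothDensity n μ)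
    (ht : testFunctions n Q ≤ 𝒜) :
    strongClosure (range (S.rep t)) =
      {T | IsSelfAdjoint T ∧ T ∈ centralizer (range (S.rep t))} := by
  ext T
  rw [mem_ofPred_eq, ContinuousLinearMap.isSelfAdjoint_iff_isSymmetric]
  constructor
  · intro hT
    have h1 := isClosed_commutant_isSymmetric (M := range (S.rep t)) (H := H)
      (preimage_mono (closure_mono (image_mono (t := _) (by
        rintro _ ⟨a, rfl⟩
        refine ⟨S.inner_rep_left t a, ?_⟩
        rintro _ ⟨b, rfl⟩ ψ
        exact DFunLike.congr_fun (S.rep_commute t a b) ψ))) hT)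
    exact ⟨h1.1, fun A hA => ContinuousLinearMap.ext fun ψ => (h1.2 A hA ψ).symm⟩
  · rintro ⟨h1, h2⟩
    exact S.mem_strongClosure_range_rep t hμ ht h1 fun a ψ =>
      (DFunLike.congr_fun (h2 _ ⟨a, rfl⟩) ψ).symm

/-- The strong closure of the positive multiplication operators is the positive part of the
commutant. -/
theorem strongClosure_positive_rep [CompleteSpace H] (hμ : IsSmoothDensity n μ)
    (ht : testFunctions n Q ≤ 𝒜) :
    strongClosure {A | A ∈ range (S.rep t) ∧ A.IsPositive} =
      {T | T.IsPositive ∧ T ∈ centralizer (range (S.rep t))} := by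
  ext T
  constructor
  · intro hT
    have h1 : T ∈ strongClosure (range (S.rep t)) :=
      preimage_mono (closure_mono (image_mono fun A hA => hA.1)) hT
    rw [S.strongClosure_range_rep t hμ ht] at h1
    have h2 := isClosed_nonneg (preimage_mono (closure_mono (image_mono fun A hA => hA.2.2)) hT)
    exact ⟨⟨ContinuousLinearMap.isSelfAdjoint_iff_isSymmetric.1 h1.1, h2⟩, h1.2⟩
  · rintro ⟨h1, h2⟩
    refine mem_strongClosure_of_forall_re_sum_inner_nonneg
      ⟨⟨0, map_zero _⟩, ContinuousLinearMap.isPositive_zero⟩ ?_ ?_ fun s φ hφ => ?_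
    · rintro _ ⟨⟨a, rfl⟩, ha⟩ _ ⟨⟨b, rfl⟩, hb⟩
      exact ⟨⟨a + b, map_add _ _ _⟩, ha.add hb⟩
    · rintro r hr _ ⟨⟨a, rfl⟩, ha⟩
      refine ⟨⟨r • a, by rw [map_smul]; ext ψ; simp⟩, ha.smul_of_nonneg ?_⟩
      exact Complex.zero_le_real.2 hr
    · exact S.re_sum_inner_nonneg_of_commute t ht hμ h1.1
        (fun a ψ => (DFunLike.congr_fun (h2 _ ⟨a, rfl⟩) ψ).symm) h1.2 φ (fun i => i.1)
        fun a ha => hφ _ ⟨⟨a, rfl⟩, S.rep_isPositive t ha⟩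

theorem dense_range_smoothLoc [CompleteSpace H] (hμ : IsSmoothDensity n μ) :
    Dense ((LinearMap.range (S.smoothLoc t hμ) : Submodule ℂ H) : Set H) := by
  rw [Submodule.dense_iff_topologicalClosure_eq_top, Submodule.topologicalClosure_eq_top_iff,
    Submodule.eq_bot_iff]
  intro φ hφ
  obtain ⟨σ, rfl⟩ := S.loc_surjective t φ
  obtain ⟨C, hC, hCx⟩ := exists_countable_smoothSections_ne_zero hE
  have h : ∀ᵐ x ∂μ, ∀ e ∈ C, (inner ℂ (e.1 x) (σ.1 x) : ℂ) = 0 :=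
    (ae_ball_iff hC).2 fun e _ => by
      refine ae_eq_zero_of_integral_testFunction_smul_eq_zero (n := n)
        (squareIntegrable_integrable_inner (smoothToSquareIntegrable hE hμ e) σ) fun f => ?_
      have h1 := (Submodule.mem_orthogonal _ _).1 hφ _
        (LinearMap.mem_range_self (S.smoothLoc t hμ) (smulSection _ (contMDiff_ofReal f.2.1) e))
      have h2 := S.inner_loc t (smoothToSquareIntegrable hE hμ
        (smulSection _ (contMDiff_ofReal f.2.1) e)) σ
      rw [← (h2.symm.trans h1)]
      refine integral_congr_ae (ae_of_all _ fun x => ?_)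
      change _ = (inner ℂ ((f.1 x : ℂ) • e.1 x) (σ.1 x) : ℂ)
      rw [inner_smul_left, Complex.conj_ofReal]
      rfl
  refine S.loc_eq_zero_of_ae t ?_
  filter_upwards [h] with x hx
  obtain ⟨e, he, hex⟩ := hCx x
  rw [eq_inner_div_smul_of_ne_zero hex (σ.1 x), hx e he, zero_div, zero_smul]

end LocalizableFamily

end StrongClosure

section Velocity

theorem smoothZeroAtInfty_contMDiff {n : ℕ} {Q : Type*} [TopologicalSpace Q]
    [ChartedSpace (EuclideanSpace ℝ (Fin n)) Q] {f : Q → ℝ} (hf : f ∈ smoothZeroAtInfty n Q) :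
    ContMDiff (𝓡 n) 𝓘(ℝ, ℝ) ∞ f :=
  (show ContMDiff (𝓡 n) 𝓘(ℝ, ℝ) ∞ f ∧ Tendsto f (cocompact Q) (𝓝 0) from hf).1

variable {n : ℕ} {Q : Type*} [TopologicalSpace Q] [ChartedSpace (EuclideanSpace ℝ (Fin n)) Q]
  [SecondCountableTopology Q] [MeasurableSpace Q]
  [BorelSpace Q] {μ : Measure Q}
  {E : Q → Type*} [∀ x, NormedAddCommGroup (E x)] [∀ x, InnerProductSpace ℂ (E x)]
  [TopologicalSpace (TotalSpace ℂ E)] [FiberBundle ℂ E] [VectorBundle ℂ ℂ E]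
  {hE : IsSmoothHermitian n E} {𝒜 : NonUnitalSubalgebra ℝ (Q → ℝ)}
  {h𝒜 : 𝒜 ≤ smoothZeroAtInfty n Q}
  {H : Type*} [NormedAddCommGroup H] [InnerProductSpace ℂ H]
  [T2Space Q] [VectorBundle ℝ ℂ E] [ContMDiffVectorBundle ∞ ℂ E (𝓡 n)]

namespace ScalarQM

variable (S : ScalarQM hE μ 𝒜 h𝒜 H) (t : ℝ) (hμ : IsSmoothDensity n μ)

theorem smoothLoc_mem (σ : smoothCompactSections n E) :
    S.smoothLoc t hμ σ ∈ S.smoothVectors t :=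
  ⟨smoothToSquareIntegrable hE hμ σ, σ.2, rfl⟩

theorem hasDerivAt_rep_smoothLoc (a : 𝒜) (σ : smoothCompactSections n E) :
    HasDerivAt (fun τ => S.rep τ a (S.smoothLoc t hμ σ)) (S.vel t a (S.smoothLoc t hμ σ)) t :=
  ((S.smooth t _ (S.smoothLoc_mem t hμ σ) a).differentiable (by simp) t).hasDerivAt

theorem exists_smoothLoc_eq_vel (a : 𝒜) (σ : smoothCompactSections n E) :
    ∃ σ', S.smoothLoc t hμ σ' = S.vel t a (S.smoothLoc t hμ σ) := by
  obtain ⟨τ, hτ, h⟩ := S.vel_mem t _ (S.smoothLoc_mem t hμ σ) a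
  exact ⟨⟨τ.1, hτ⟩, h⟩

/-- The velocity `ȧ_t` as an operator on smooth compactly supported sections. -/
noncomputable def velocity (a : 𝒜) : smoothCompactSections n E →ₗ[ℂ] smoothCompactSections n E where
  toFun σ := (S.exists_smoothLoc_eq_vel t hμ a σ).choose
  map_add' σ τ := S.smoothLoc_injective t hμ <| by
    refine (S.exists_smoothLoc_eq_vel t hμ a (σ + τ)).choose_spec.trans
      (Eq.trans ?_ (map_add _ _ _).symm)
    refine Eq.trans ?_ (congrArg₂ (· + ·) (S.exists_smoothLoc_eq_vel t hμ a σ).choose_spec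
      (S.exists_smoothLoc_eq_vel t hμ a τ).choose_spec).symm
    refine (S.hasDerivAt_rep_smoothLoc t hμ a _).unique ?_
    simpa only [map_add] using! (S.hasDerivAt_rep_smoothLoc t hμ a σ).add
      (S.hasDerivAt_rep_smoothLoc t hμ a τ)
  map_smul' c σ := S.smoothLoc_injective t hμ <| by
    refine (S.exists_smoothLoc_eq_vel t hμ a (c • σ)).choose_spec.trans
      (Eq.trans ?_ (map_smul _ _ _).symm)
    refine Eq.trans ?_ (congrArg (c • ·) (S.exists_smoothLoc_eq_vel t hμ a σ).choose_spec).symm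
    refine (S.hasDerivAt_rep_smoothLoc t hμ a _).unique ?_
    simpa only [map_smul] using! (S.hasDerivAt_rep_smoothLoc t hμ a σ).const_smul c

theorem hasDerivAt_velocity (a : 𝒜) (σ : smoothCompactSections n E) :
    HasDerivAt (fun τ => S.rep τ a (S.smoothLoc t hμ σ))
      (S.smoothLoc t hμ (S.velocity t hμ a σ)) t := by
  have h : S.smoothLoc t hμ (S.velocity t hμ a σ) = S.vel t a (S.smoothLoc t hμ σ) :=
    (S.exists_smoothLoc_eq_vel t hμ a σ).choose_spec
  rw [h]
  exact S.hasDerivAt_rep_smoothLoc t hμ a σ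

variable {S t} in
theorem velocity_eq_of_hasDerivAt {a : 𝒜} {σ τ : smoothCompactSections n E}
    (h : HasDerivAt (fun s => S.rep s a (S.smoothLoc t hμ σ)) (S.smoothLoc t hμ τ) t) :
    S.velocity t hμ a σ = τ :=
  S.smoothLoc_injective t hμ ((S.hasDerivAt_velocity t hμ a σ).unique h)

theorem velocity_add (a b : 𝒜) (σ : smoothCompactSections n E) :
    S.velocity t hμ (a + b) σ = S.velocity t hμ a σ + S.velocity t hμ b σ :=
  velocity_eq_of_hasDerivAt hμ <| by
    simpa only [map_add, add_apply] using!
      (S.hasDerivAt_velocity t hμ a σ).add (S.hasDerivAt_velocity t hμ b σ)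

theorem velocity_smul (r : ℝ) (a : 𝒜) (σ : smoothCompactSections n E) :
    S.velocity t hμ (r • a) σ = (r : ℂ) • S.velocity t hμ a σ :=
  velocity_eq_of_hasDerivAt hμ <| by
    have h := (S.hasDerivAt_velocity t hμ a σ).const_smul (r : ℂ)
    rw [← map_smul] at h
    refine h.congr_deriv rfl |>.congr_of_eventuallyEq (Eventually.of_forall fun s => ?_)
    simp

/-- Multiplication by a function of the algebra, on smooth sections. -/
noncomputable def mulSmooth (h𝒜 : 𝒜 ≤ smoothZeroAtInfty n Q) (a : 𝒜) :
    smoothCompactSections n E →ₗ[ℂ] smoothCompactSections n E :=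
  smulSection _ (contMDiff_ofReal (smoothZeroAtInfty_contMDiff (h𝒜 a.2)))

theorem rep_smoothLoc (a : 𝒜) (σ : smoothCompactSections n E) :
    S.rep t a (S.smoothLoc t hμ σ) = S.smoothLoc t hμ (mulSmooth h𝒜 a σ) :=
  S.rep_loc t a _

theorem inner_mulSmooth_left (a : 𝒜) (σ τ : smoothCompactSections n E) :
    inner ℂ (S.smoothLoc t hμ (mulSmooth h𝒜 a σ)) (S.smoothLoc t hμ τ) =
      inner ℂ (S.smoothLoc t hμ σ) (S.smoothLoc t hμ (mulSmooth h𝒜 a τ)) := by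
  rw [← rep_smoothLoc, ← rep_smoothLoc, S.inner_rep_left]

/-- The velocities are symmetric. -/
theorem inner_velocity_left (a : 𝒜) (σ τ : smoothCompactSections n E) :
    inner ℂ (S.smoothLoc t hμ (S.velocity t hμ a σ)) (S.smoothLoc t hμ τ) =
      inner ℂ (S.smoothLoc t hμ σ) (S.smoothLoc t hμ (S.velocity t hμ a τ)) := by
  have h1 := (S.hasDerivAt_velocity t hμ a σ).inner ℂ (hasDerivAt_const t (S.smoothLoc t hμ τ))
  have h2 := (hasDerivAt_const t (S.smoothLoc t hμ σ)).inner ℂ (S.hasDerivAt_velocity t hμ a τ)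
  simp only [S.inner_rep_left] at h1
  simpa only [map_zero, inner_zero_left, inner_zero_right, zero_add, add_zero] using h1.unique h2

theorem smooth_ext_inner {σ τ : smoothCompactSections n E}
    (h : ∀ φ, inner ℂ (S.smoothLoc t hμ φ) (S.smoothLoc t hμ σ) =
      inner ℂ (S.smoothLoc t hμ φ) (S.smoothLoc t hμ τ)) : σ = τ := by
  refine S.smoothLoc_injective t hμ (sub_eq_zero.1 (inner_self_eq_zero (𝕜 := ℂ).1 ?_))
  rw [← map_sub, map_sub, inner_sub_right, ← map_sub, h, sub_self]

/-- The product rule for velocities. -/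
theorem velocity_mul (a b : 𝒜) (σ : smoothCompactSections n E) :
    S.velocity t hμ (a * b) σ =
      S.velocity t hμ a (mulSmooth h𝒜 b σ) + mulSmooth h𝒜 a (S.velocity t hμ b σ) := by
  refine S.smooth_ext_inner t hμ fun φ => ?_
  have h1 := (hasDerivAt_const t (S.smoothLoc t hμ φ)).inner ℂ (S.hasDerivAt_velocity t hμ (a * b) σ)
  have h2 := (S.hasDerivAt_velocity t hμ a φ).inner ℂ (S.hasDerivAt_velocity t hμ b σ)
  have h3 : ∀ s, inner ℂ (S.smoothLoc t hμ φ) (S.rep s (a * b) (S.smoothLoc t hμ σ)) =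
      inner ℂ (S.rep s a (S.smoothLoc t hμ φ)) (S.rep s b (S.smoothLoc t hμ σ)) := fun s => by
    rw [S.inner_rep_left, map_mul, mul_apply_eq_comp]
  simp only [h3, inner_zero_left, add_zero] at h1
  rw [h1.unique h2, map_add, inner_add_right, S.rep_smoothLoc, S.rep_smoothLoc, S.inner_velocity_left,
    S.inner_mulSmooth_left, add_comm]

theorem exists_velocity_mulSmooth (a b : 𝒜) : ∃ c : 𝒜, ∀ (σ : smoothCompactSections n E) (x : Q),
    (S.velocity t hμ b (mulSmooth h𝒜 a σ)).1 x =
      (a.1 x : ℂ) • (S.velocity t hμ b σ).1 x + (Complex.I * c.1 x) • σ.1 x := by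
  obtain ⟨c, hc⟩ := S.uncertainty t a b
  refine ⟨c, fun σ x => ?_⟩
  have h1 := hc _ (S.smoothLoc_mem t hμ σ)
  have h2 : ∀ τ, S.vel t b (S.smoothLoc t hμ τ) = S.smoothLoc t hμ (S.velocity t hμ b τ) :=
    fun τ => (S.hasDerivAt_velocity t hμ b τ).deriv
  rw [LocalizableFamily.comm, S.rep_smoothLoc, h2, h2, S.rep_smoothLoc, S.rep_smoothLoc,
    ← map_sub, ← map_smul] at h1
  have h3 := congrArg (fun τ => τ.1 x) (S.smoothLoc_injective t hμ h1)
  change Complex.I • ((a.1 x : ℂ) • (S.velocity t hμ b σ).1 x -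
    (S.velocity t hμ b (mulSmooth h𝒜 a σ)).1 x) = (c.1 x : ℂ) • σ.1 x at h3
  rw [mul_smul, ← h3, smul_smul, Complex.I_mul_I, neg_one_smul]
  abel

variable [IsManifold (𝓡 n) ∞ Q]

/-- Velocities are local operators. -/
theorem velocity_eq_zero_of_eventuallyEq_zero (ht : testFunctions n Q ≤ 𝒜) (b : 𝒜)
    {σ : smoothCompactSections n E} {p : Q} (hσ : ∀ᶠ x in 𝓝 p, σ.1 x = 0) :
    (S.velocity t hμ b σ).1 p = 0 := by
  obtain ⟨f, hf1, hf2, -⟩ := exists_testFunction_eventuallyEq_one (n := n) hσ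
  obtain ⟨c, hc⟩ := S.exists_velocity_mulSmooth t hμ ⟨f.1, ht f.2⟩ b
  have h0 : mulSmooth h𝒜 ⟨f.1, ht f.2⟩ σ = 0 := by
    ext x
    change (f.1 x : ℂ) • σ.1 x = 0
    by_cases hx : x ∈ tsupport f.1
    · rw [show σ.1 x = 0 from hf2 hx, smul_zero]
    · rw [image_eq_zero_of_notMem_tsupport hx, Complex.ofReal_zero, zero_smul]
  have h1 := hc σ p
  rw [h0, map_zero, hσ.self_of_nhds, smul_zero, add_zero] at h1
  change (0 : E p) = (f.1 p : ℂ) • _ at h1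
  rw [hf1.eq_of_nhds] at h1
  simpa using h1.symm

/-- For `e` supported in a chart domain, the distribution `f ↦ ⟪e, ḟ_t φ⟫` is a smooth density. -/
theorem exists_inner_velocity_eq_integral (ht : testFunctions n Q ≤ 𝒜)
    {e : smoothCompactSections n E} (φ : smoothCompactSections n E) {x₀ : Q} {K : Set Q}
    (hK : IsCompact K) (hKs : K ⊆ (chartAt (EuclideanSpace ℝ (Fin n)) x₀).source)
    (he : ∀ x ∉ K, e.1 x = 0) :
    ∃ w : Q → ℂ, ContMDiff (𝓡 n) 𝓘(ℝ, ℂ) ∞ w ∧ ∀ f : testFunctions n Q,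
      inner ℂ (S.smoothLoc t hμ e) (S.smoothLoc t hμ (S.velocity t hμ ⟨f.1, ht f.2⟩ φ)) =
        ∫ x, f.1 x • w x ∂μ := by
  have := hμ.isLocallyFiniteMeasure
  let ι : testFunctions n Q → 𝒜 := fun f => ⟨f.1, ht f.2⟩
  let X : testFunctions n Q →ₗ[ℝ] (Q → ℂ) :=
    { toFun := fun f x => inner ℂ (e.1 x) ((S.velocity t hμ (ι f) φ).1 x) +
        inner ℂ ((S.velocity t hμ (ι f) e).1 x) (φ.1 x)
      map_add' := fun f g => funext fun x => by
        change inner ℂ (e.1 x) ((S.velocity t hμ (ι f + ι g) φ).1 x) +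
          inner ℂ ((S.velocity t hμ (ι f + ι g) e).1 x) (φ.1 x) = _
        rw [velocity_add, velocity_add]
        change inner ℂ (e.1 x) ((S.velocity t hμ (ι f) φ).1 x + (S.velocity t hμ (ι g) φ).1 x) +
          inner ℂ ((S.velocity t hμ (ι f) e).1 x + (S.velocity t hμ (ι g) e).1 x) (φ.1 x) =
          (inner ℂ (e.1 x) ((S.velocity t hμ (ι f) φ).1 x) +
            inner ℂ ((S.velocity t hμ (ι f) e).1 x) (φ.1 x)) +
          (inner ℂ (e.1 x) ((S.velocity t hμ (ι g) φ).1 x) +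
            inner ℂ ((S.velocity t hμ (ι g) e).1 x) (φ.1 x))
        rw [inner_add_left, inner_add_right]
        ring
      map_smul' := fun r f => funext fun x => by
        change inner ℂ (e.1 x) ((S.velocity t hμ (r • ι f) φ).1 x) +
          inner ℂ ((S.velocity t hμ (r • ι f) e).1 x) (φ.1 x) = _
        rw [velocity_smul, velocity_smul]
        change inner ℂ (e.1 x) ((r : ℂ) • (S.velocity t hμ (ι f) φ).1 x) +
          inner ℂ ((r : ℂ) • (S.velocity t hμ (ι f) e).1 x) (φ.1 x) =
          r • (inner ℂ (e.1 x) ((S.velocity t hμ (ι f) φ).1 x) +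
            inner ℂ ((S.velocity t hμ (ι f) e).1 x) (φ.1 x))
        rw [inner_smul_left, inner_smul_right, Complex.conj_ofReal, Complex.real_smul]
        ring }
  have hX : ∀ (f g : testFunctions n Q) x, X (f * g) x = f.1 x * X g x + g.1 x * X f x := by
    intro f g x
    obtain ⟨c, hc⟩ := S.exists_velocity_mulSmooth t hμ (ι g) (ι f)
    have h1 : ∀ σ : smoothCompactSections n E, (S.velocity t hμ (ι (f * g)) σ).1 x =
        ((g.1 x : ℂ) • (S.velocity t hμ (ι f) σ).1 x + (Complex.I * c.1 x) • σ.1 x) +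
          (f.1 x : ℂ) • (S.velocity t hμ (ι g) σ).1 x := fun σ => by
      rw [← hc σ x, show ι (f * g) = ι f * ι g from rfl, velocity_mul]
      rfl
    change inner ℂ (e.1 x) ((S.velocity t hμ (ι (f * g)) φ).1 x) +
      inner ℂ ((S.velocity t hμ (ι (f * g)) e).1 x) (φ.1 x) =
      f.1 x * (inner ℂ (e.1 x) ((S.velocity t hμ (ι g) φ).1 x) +
        inner ℂ ((S.velocity t hμ (ι g) e).1 x) (φ.1 x)) +
      g.1 x * (inner ℂ (e.1 x) ((S.velocity t hμ (ι f) φ).1 x) +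
        inner ℂ ((S.velocity t hμ (ι f) e).1 x) (φ.1 x))
    rw [h1, h1]
    simp only [inner_add_left, inner_add_right, inner_smul_left, inner_smul_right, map_mul,
      Complex.conj_ofReal, Complex.conj_I]
    ring
  have hX0 : ∀ f, ∀ x ∉ K, X f x = 0 := fun f x hx => by
    have h1 : ∀ᶠ y in 𝓝 x, e.1 y = 0 := by
      filter_upwards [hK.isClosed.isOpen_compl.mem_nhds hx] with y hy using he y hy
    change inner ℂ (e.1 x) _ + inner ℂ ((S.velocity t hμ (ι f) e).1 x) _ = (0 : ℂ)
    rw [he x hx, S.velocity_eq_zero_of_eventuallyEq_zero t hμ ht _ h1, inner_zero_left,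
      inner_zero_left, add_zero]
  obtain ⟨w, hw, hwX⟩ := exists_integral_derivation_eq hμ hX
    (fun f => (contMDiff_inner hE e _).add (contMDiff_inner hE _ φ)) hK hKs hX0
  refine ⟨fun x => (2⁻¹ : ℂ) * w x, contMDiff_const.complex_mul hw, fun f => ?_⟩
  have hi : ∀ σ τ : smoothCompactSections n E,
      Integrable (fun x => (inner ℂ (σ.1 x) (τ.1 x) : ℂ)) μ := fun σ τ =>
    (contMDiff_inner hE σ τ).continuous.integrable_of_hasCompactSupport (hasCompactSupport_inner σ τ)
  have h2 : ∫ x, X f x ∂μ =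
      inner ℂ (S.smoothLoc t hμ e) (S.smoothLoc t hμ (S.velocity t hμ (ι f) φ)) +
      inner ℂ (S.smoothLoc t hμ (S.velocity t hμ (ι f) e)) (S.smoothLoc t hμ φ) := by
    rw [S.inner_smoothLoc, S.inner_smoothLoc, ← integral_add (hi _ _) (hi _ _)]
    rfl
  rw [S.inner_velocity_left, ← two_mul, hwX] at h2
  have h3 : ∫ x, f.1 x • ((2⁻¹ : ℂ) * w x) ∂μ = 2⁻¹ * ∫ x, f.1 x • w x ∂μ := by
    rw [← integral_const_mul]
    exact integral_congr_ae (ae_of_all _ fun x => mul_smul_comm _ _ _ |>.symm)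
  rw [h3, h2, inv_mul_cancel_left₀ two_ne_zero]

end ScalarQM

end Velocity

section LinearAlgebra

theorem LinearMap.exists_eq_sum_of_finite {ι R M N : Type*} [CommRing R] [AddCommGroup M]
    [Module R M] [AddCommGroup N] [Module R N] (h : ι → M →ₗ[R] N)
    (hf : ∀ m, {i | h i m ≠ 0}.Finite) :
    ∃ T : M →ₗ[R] N, ∀ m (s : Finset ι), (∀ i ∉ s, h i m = 0) → T m = ∑ i ∈ s, h i m := by
  refine ⟨
    { toFun := fun m => ∑ᶠ i, h i m
      map_add' := fun m m' => by
        simp only [map_add]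
        exact finsum_add_distrib (hf m) (hf m')
      map_smul' := fun c m => by
        simp only [map_smul, RingHom.id_apply]
        exact (smul_finsum' c (hf m)).symm }, fun m s hs => ?_⟩
  refine finsum_eq_sum_of_support_subset _ fun i hi => ?_
  by_contra h'
  exact hi (hs i h')

theorem LinearMap.exists_formal_adjoint {M H : Type*} [AddCommGroup M] [Module ℂ M]
    [NormedAddCommGroup H] [InnerProductSpace ℂ H] {J : M →ₗ[ℂ] H} (hJ : Function.Injective J)
    {T : M →ₗ[ℂ] M} (h : ∀ φ, ∃ χ, ∀ ψ, inner ℂ (J (T ψ)) (J φ) = inner ℂ (J ψ) (J χ)) :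
    ∃ T' : M →ₗ[ℂ] M, ∀ ψ φ, inner ℂ (J (T ψ)) (J φ) = inner ℂ (J ψ) (J (T' φ)) := by
  have hext : ∀ {χ χ' : M}, (∀ ψ, inner ℂ (J ψ) (J χ) = inner ℂ (J ψ) (J χ')) → χ = χ' := by
    intro χ χ' hχ
    refine hJ (sub_eq_zero.1 (inner_self_eq_zero (𝕜 := ℂ).1 ?_))
    rw [← map_sub, map_sub, inner_sub_right, ← map_sub, hχ, sub_self]
  choose F hF using h
  refine ⟨{ toFun := F, map_add' := fun φ φ' => hext fun ψ => ?_,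
            map_smul' := fun c φ => hext fun ψ => ?_ }, fun ψ φ => hF φ ψ⟩
  · rw [← hF, map_add, inner_add_right, hF, hF, map_add, inner_add_right]
  · rw [← hF, map_smul, inner_smul_right, hF, RingHom.id_apply, map_smul, inner_smul_right]

end LinearAlgebra

section Frame

universe u

variable {n : ℕ} {Q : Type u} [TopologicalSpace Q] [ChartedSpace (EuclideanSpace ℝ (Fin n)) Q]
  [SecondCountableTopology Q] [T2Space Q] [IsManifold (𝓡 n) ∞ Q]
  {E : Q → Type*} [∀ x, NormedAddCommGroup (E x)] [∀ x, InnerProductSpace ℂ (E x)]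
  [TopologicalSpace (TotalSpace ℂ E)] [FiberBundle ℂ E] [VectorBundle ℂ ℂ E]
  [VectorBundle ℝ ℂ E] [ContMDiffVectorBundle ∞ ℂ E (𝓡 n)]

theorem exists_locallyFinite_dual_frames (hE : IsSmoothHermitian n E) :
    ∃ (ι : Type u) (e e' : ι → smoothCompactSections n E) (K : ι → Set Q) (c : ι → Q),
      (∀ i, IsCompact (K i)) ∧
      (∀ i, K i ⊆ (chartAt (EuclideanSpace ℝ (Fin n)) (c i)).source) ∧ LocallyFinite K ∧
      (∀ i, ∀ x ∉ K i, (e i).1 x = 0) ∧ (∀ i, ∀ x ∉ K i, (e' i).1 x = 0) ∧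
      ∀ (ψ : ∀ x, E x) (s : Finset ι) (x : Q), (∀ i ∉ s, x ∉ K i) →
        ∑ i ∈ s, (inner ℂ ((e' i).1 x) (ψ x) : ℂ) • (e i).1 x = ψ x := by
  have := sigmaCompactSpace_of_chartedSpace_euclideanSpace n Q
  obtain ⟨ι, f, hf⟩ := SmoothBumpCovering.exists_isSubordinate (𝓡 n) (isClosed_univ (X := Q))
    (U := fun x => (chartAt (EuclideanSpace ℝ (Fin n)) x).source ∩
      (trivializationAt ℂ E x).baseSet)
    (fun x _ => inter_mem ((chartAt _ x).open_source.mem_nhds (mem_chart_source _ x))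
      ((trivializationAt ℂ E x).open_baseSet.mem_nhds
        (FiberBundle.mem_baseSet_trivializationAt ℂ E x)))
  let b : ι → testFunctions n Q := fun i => ⟨f i, (f i).contMDiff, (f i).hasCompactSupport⟩
  have hfs : ∀ i, tsupport (b i).1 ⊆ (trivializationAt ℂ E (f.c i)).baseSet := fun i =>
    (hf i).trans inter_subset_right
  let R : Q → ℝ := fun x => ∑ᶠ i, f i x ^ 2
  have hRs : ∀ x (s : Finset ι), (∀ i ∉ s, x ∉ tsupport (f i)) → R x = ∑ i ∈ s, f i x ^ 2 :=
    fun x s hs => finsum_eq_sum_of_support_subset _ fun i hi => by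
      by_contra h
      exact hi (by simp only [image_eq_zero_of_notMem_tsupport (hs i h), zero_pow two_ne_zero])
  have hR : ContMDiff (𝓡 n) 𝓘(ℝ, ℝ) ∞ R :=
    contMDiff_finsum (fun i => (f i).contMDiff.pow 2) (f.locallyFinite.subset fun i x hx h => hx <| by
      change f i x ^ 2 = 0
      rw [h, zero_pow two_ne_zero])
  have hRpos : ∀ x, 0 < R x := fun x => by
    have hfin : {i | f i x ≠ 0}.Finite := f.point_finite x
    have h1 : R x = ∑ i ∈ hfin.toFinset, f i x ^ 2 :=
      finsum_eq_sum_of_support_subset _ fun i hi => by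
        rw [Finite.coe_toFinset]
        intro h
        exact hi (by change f i x ^ 2 = 0; rw [h, zero_pow two_ne_zero])
    rw [h1]
    refine Finset.sum_pos' (fun i _ => sq_nonneg _) ⟨f.ind x trivial, ?_, ?_⟩
    · rw [Finite.mem_toFinset, mem_ofPred_eq, f.apply_ind x trivial]
      exact one_ne_zero
    · rw [f.apply_ind x trivial]
      norm_num
  have hh : ∀ i, ContMDiffOn (𝓡 n) 𝓘(ℝ, ℂ) ∞
      (fun x => (((‖(trivializationAt ℂ E (f.c i)).symm x (1 : ℂ)‖ ^ 2 * R x)⁻¹ : ℝ) : ℂ))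
      (trivializationAt ℂ E (f.c i)).baseSet := fun i =>
    Complex.ofRealCLM.contDiff.contMDiff.comp_contMDiffOn
      (((hE (f.c i)).mul hR.contMDiffOn).inv₀ fun x hx =>
        mul_ne_zero (pow_ne_zero 2 (norm_ne_zero_iff.2 (frame_ne_zero hx))) (hRpos x).ne')
  refine ⟨ι, fun i => ⟨_, smoothSection_frame_mem (b i) (hfs i) (contMDiffOn_const (c := (1 : ℂ)))⟩,
    fun i => ⟨_, smoothSection_frame_mem (b i) (hfs i) (hh i)⟩, fun i => tsupport (f i), f.c,
    fun i => (f i).hasCompactSupport, fun i => (hf i).trans inter_subset_left,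
    f.locallyFinite.closure, fun i x hx => ?_, fun i x hx => ?_, fun ψ s x hs => ?_⟩
  · change (f i x • (1 : ℂ)) • (trivializationAt ℂ E (f.c i)).symm x (1 : ℂ) = 0
    rw [image_eq_zero_of_notMem_tsupport hx, zero_smul, zero_smul]
  · change (f i x • (_ : ℂ)) • (trivializationAt ℂ E (f.c i)).symm x (1 : ℂ) = 0
    rw [image_eq_zero_of_notMem_tsupport hx, zero_smul, zero_smul]
  · have h1 : ∀ i, (inner ℂ ((f i x • (((‖(trivializationAt ℂ E (f.c i)).symm x (1 : ℂ)‖ ^ 2 *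
        R x)⁻¹ : ℝ) : ℂ)) • (trivializationAt ℂ E (f.c i)).symm x (1 : ℂ)) (ψ x) : ℂ) •
        ((f i x • (1 : ℂ)) • (trivializationAt ℂ E (f.c i)).symm x (1 : ℂ)) =
        ((f i x ^ 2 * (R x)⁻¹ : ℝ) : ℂ) • ψ x := by
      intro i
      by_cases hx : x ∈ tsupport (f i)
      · have hu := frame_ne_zero (hfs i hx)
        set u := (trivializationAt ℂ E (f.c i)).symm x (1 : ℂ)
        have h2 := eq_inner_div_smul_of_ne_zero hu (ψ x)
        have hu' : (‖u‖ : ℂ) ≠ 0 := by simpa using hu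
        have hR' : (R x : ℂ) ≠ 0 := by simpa using (hRpos x).ne'
        conv_rhs => rw [h2]
        rw [inner_smul_left, smul_smul, smul_smul, Complex.real_smul, Complex.real_smul, map_mul,
          Complex.conj_ofReal, Complex.conj_ofReal]
        congr 1
        push_cast
        field_simp
      · rw [image_eq_zero_of_notMem_tsupport hx]
        simp
    refine (Finset.sum_congr rfl fun i _ => h1 i).trans ?_
    rw [← Finset.sum_smul, ← Complex.ofReal_sum, ← Finset.sum_mul, ← hRs x s hs,
      mul_inv_cancel₀ (hRpos x).ne', Complex.ofReal_one, one_smul]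

end Frame

section Hamiltonian

variable {n : ℕ} {Q : Type*} [TopologicalSpace Q] [ChartedSpace (EuclideanSpace ℝ (Fin n)) Q]
  [SecondCountableTopology Q] [MeasurableSpace Q]
  [BorelSpace Q] {μ : Measure Q}
  {E : Q → Type*} [∀ x, NormedAddCommGroup (E x)] [∀ x, InnerProductSpace ℂ (E x)]
  [TopologicalSpace (TotalSpace ℂ E)] [FiberBundle ℂ E] [VectorBundle ℂ ℂ E]
  {hE : IsSmoothHermitian n E} {𝒜 : NonUnitalSubalgebra ℝ (Q → ℝ)}
  {h𝒜 : 𝒜 ≤ smoothZeroAtInfty n Q}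
  {H : Type*} [NormedAddCommGroup H] [InnerProductSpace ℂ H]
  [T2Space Q] [VectorBundle ℝ ℂ E] [ContMDiffVectorBundle ∞ ℂ E (𝓡 n)]

namespace ScalarQM

variable (S : ScalarQM hE μ 𝒜 h𝒜 H) (t : ℝ) (hμ : IsSmoothDensity n μ)
  (ht : testFunctions n Q ≤ 𝒜)

/-- `ψ ↦ i ȧ_t e` with `a = ⟪e', ψ⟫` the pointwise inner product (complex-linearly extended to
complex `a`). -/
noncomputable def frameTerm (e e' : smoothCompactSections n E) :
    smoothCompactSections n E →ₗ[ℂ] smoothCompactSections n E where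
  toFun ψ := Complex.I • (S.velocity t hμ ⟨_, ht (innerRe hE e' ψ).2⟩ e +
    Complex.I • S.velocity t hμ ⟨_, ht (innerIm hE e' ψ).2⟩ e)
  map_add' ψ φ := by
    have h1 : (⟨_, ht (innerRe hE e' (ψ + φ)).2⟩ : 𝒜) =
        ⟨_, ht (innerRe hE e' ψ).2⟩ + ⟨_, ht (innerRe hE e' φ).2⟩ := by
      ext x
      change (inner ℂ (e'.1 x) (ψ.1 x + φ.1 x) : ℂ).re = _
      rw [inner_add_right]
      rfl
    have h2 : (⟨_, ht (innerIm hE e' (ψ + φ)).2⟩ : 𝒜) =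
        ⟨_, ht (innerIm hE e' ψ).2⟩ + ⟨_, ht (innerIm hE e' φ).2⟩ := by
      ext x
      change (inner ℂ (e'.1 x) (ψ.1 x + φ.1 x) : ℂ).im = _
      rw [inner_add_right]
      rfl
    rw [h1, h2, velocity_add, velocity_add]
    module
  map_smul' c ψ := by
    have h1 : (⟨_, ht (innerRe hE e' (c • ψ)).2⟩ : 𝒜) =
        c.re • ⟨_, ht (innerRe hE e' ψ).2⟩ + (-c.im) • ⟨_, ht (innerIm hE e' ψ).2⟩ := by
      ext x
      change (inner ℂ (e'.1 x) (c • ψ.1 x) : ℂ).re =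
        c.re * (inner ℂ (e'.1 x) (ψ.1 x) : ℂ).re + -c.im * (inner ℂ (e'.1 x) (ψ.1 x) : ℂ).im
      rw [inner_smul_right, Complex.mul_re]
      ring
    have h2 : (⟨_, ht (innerIm hE e' (c • ψ)).2⟩ : 𝒜) =
        c.re • ⟨_, ht (innerIm hE e' ψ).2⟩ + c.im • ⟨_, ht (innerRe hE e' ψ).2⟩ := by
      ext x
      change (inner ℂ (e'.1 x) (c • ψ.1 x) : ℂ).im =
        c.re * (inner ℂ (e'.1 x) (ψ.1 x) : ℂ).im + c.im * (inner ℂ (e'.1 x) (ψ.1 x) : ℂ).re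
      rw [inner_smul_right, Complex.mul_im]
    rw [h1, h2, velocity_add, velocity_add, velocity_smul, velocity_smul, velocity_smul,
      velocity_smul, RingHom.id_apply]
    generalize S.velocity t hμ ⟨_, ht (innerRe hE e' ψ).2⟩ e = v
    generalize S.velocity t hμ ⟨_, ht (innerIm hE e' ψ).2⟩ e = w
    have hI : Complex.I * Complex.I = -1 := Complex.I_mul_I
    have hc : c = c.re + c.im * Complex.I := (Complex.re_add_im c).symm
    generalize c.re = a at hc ⊢
    generalize c.im = b at hc ⊢
    subst hc
    simp only [smul_add, smul_smul, Complex.ofReal_neg]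
    rw [show Complex.I * -(b : ℂ) = ((a + b * Complex.I) * (Complex.I * Complex.I)) -
      Complex.I * (Complex.I * a) by linear_combination (-(b : ℂ) * Complex.I) * hI]
    rw [show (a + b * Complex.I) * Complex.I = Complex.I * a + Complex.I * (Complex.I * b) by ring]
    module

theorem frameTerm_eq_zero {e e' ψ : smoothCompactSections n E}
    (h : ∀ x, (inner ℂ (e'.1 x) (ψ.1 x) : ℂ) = 0) : S.frameTerm t hμ ht e e' ψ = 0 := by
  have h1 : (⟨_, ht (innerRe hE e' ψ).2⟩ : 𝒜) = (0 : ℝ) • ⟨_, ht (innerRe hE e' ψ).2⟩ := by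
    rw [zero_smul]
    ext x
    change (inner ℂ (e'.1 x) (ψ.1 x) : ℂ).re = 0
    rw [h, Complex.zero_re]
  have h2 : (⟨_, ht (innerIm hE e' ψ).2⟩ : 𝒜) = (0 : ℝ) • ⟨_, ht (innerIm hE e' ψ).2⟩ := by
    rw [zero_smul]
    ext x
    change (inner ℂ (e'.1 x) (ψ.1 x) : ℂ).im = 0
    rw [h, Complex.zero_im]
  change Complex.I • (S.velocity t hμ _ e + Complex.I • S.velocity t hμ _ e) = 0
  rw [h1, h2, velocity_smul, velocity_smul]
  simp

theorem frameTerm_mulSmooth (e e' ψ : smoothCompactSections n E) (a : 𝒜)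
    {θ : smoothCompactSections n E}
    (hθ : ∀ x, θ.1 x = (inner ℂ (e'.1 x) (ψ.1 x) : ℂ) • e.1 x) :
    S.frameTerm t hμ ht e e' (mulSmooth h𝒜 a ψ) =
      Complex.I • S.velocity t hμ a θ + mulSmooth h𝒜 a (S.frameTerm t hμ ht e e' ψ) := by
  have h1 : (⟨_, ht (innerRe hE e' (mulSmooth h𝒜 a ψ)).2⟩ : 𝒜) =
      a * ⟨_, ht (innerRe hE e' ψ).2⟩ := by
    ext x
    change (inner ℂ (e'.1 x) ((a.1 x : ℂ) • ψ.1 x) : ℂ).re = a.1 x * (inner ℂ (e'.1 x) (ψ.1 x) : ℂ).re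
    rw [inner_smul_right, Complex.re_ofReal_mul]
  have h2 : (⟨_, ht (innerIm hE e' (mulSmooth h𝒜 a ψ)).2⟩ : 𝒜) =
      a * ⟨_, ht (innerIm hE e' ψ).2⟩ := by
    ext x
    change (inner ℂ (e'.1 x) ((a.1 x : ℂ) • ψ.1 x) : ℂ).im = a.1 x * (inner ℂ (e'.1 x) (ψ.1 x) : ℂ).im
    rw [inner_smul_right, Complex.im_ofReal_mul]
  have h3 : θ = mulSmooth h𝒜 ⟨_, ht (innerRe hE e' ψ).2⟩ e +
      Complex.I • mulSmooth h𝒜 ⟨_, ht (innerIm hE e' ψ).2⟩ e := by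
    ext x
    refine (hθ x).trans ?_
    change _ = ((inner ℂ (e'.1 x) (ψ.1 x) : ℂ).re : ℂ) • e.1 x +
      Complex.I • (((inner ℂ (e'.1 x) (ψ.1 x) : ℂ).im : ℂ) • e.1 x)
    rw [smul_smul, ← add_smul, mul_comm Complex.I, Complex.re_add_im]
  change Complex.I • (S.velocity t hμ _ e + Complex.I • S.velocity t hμ _ e) =
    _ + mulSmooth h𝒜 a (Complex.I • (S.velocity t hμ _ e + Complex.I • S.velocity t hμ _ e))
  rw [h1, h2, velocity_mul, velocity_mul, h3]
  simp only [map_add, map_smul]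
  module

theorem inner_frameTerm_left (e e' ψ φ : smoothCompactSections n E) :
    inner ℂ (S.smoothLoc t hμ (S.frameTerm t hμ ht e e' ψ)) (S.smoothLoc t hμ φ) =
      -Complex.I * (inner ℂ (S.smoothLoc t hμ e)
          (S.smoothLoc t hμ (S.velocity t hμ ⟨_, ht (innerRe hE e' ψ).2⟩ φ)) -
        Complex.I * inner ℂ (S.smoothLoc t hμ e)
          (S.smoothLoc t hμ (S.velocity t hμ ⟨_, ht (innerIm hE e' ψ).2⟩ φ))) := by
  change inner ℂ (S.smoothLoc t hμ (Complex.I • (S.velocity t hμ _ e +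
    Complex.I • S.velocity t hμ _ e))) _ = _
  rw [map_smul, map_add, map_smul, inner_smul_left, inner_add_left, inner_smul_left,
    inner_velocity_left, inner_velocity_left, Complex.conj_I]
  ring

variable [IsManifold (𝓡 n) ∞ Q]

theorem inner_frameTerm_eq_zero {e e' φ : smoothCompactSections n E} {K L : Set Q}
    (hL : IsClosed L) (he : ∀ x ∉ K, e.1 x = 0) (hφ : ∀ x ∉ L, φ.1 x = 0) (hKL : Disjoint K L)
    (ψ : smoothCompactSections n E) :
    inner ℂ (S.smoothLoc t hμ (S.frameTerm t hμ ht e e' ψ)) (S.smoothLoc t hμ φ) = 0 := by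
  have h : ∀ b : 𝒜, inner ℂ (S.smoothLoc t hμ e)
      (S.smoothLoc t hμ (S.velocity t hμ b φ)) = 0 := fun b => by
    rw [S.inner_smoothLoc]
    refine integral_eq_zero_of_ae (ae_of_all _ fun x => ?_)
    by_cases hx : x ∈ K
    · have h1 : ∀ᶠ y in 𝓝 x, φ.1 y = 0 := by
        filter_upwards [hL.isOpen_compl.mem_nhds (disjoint_left.1 hKL hx)] with y hy using hφ y hy
      change inner ℂ (e.1 x) ((S.velocity t hμ b φ).1 x) = (0 : ℂ)
      rw [S.velocity_eq_zero_of_eventuallyEq_zero t hμ ht b h1, inner_zero_right]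
    · change inner ℂ (e.1 x) ((S.velocity t hμ b φ).1 x) = (0 : ℂ)
      rw [he x hx, inner_zero_left]
  rw [inner_frameTerm_left, h, h]
  simp

theorem exists_adjoint_frameTerm {e : smoothCompactSections n E}
    (e' φ : smoothCompactSections n E) {x₀ : Q} {K : Set Q} (hK : IsCompact K)
    (hKs : K ⊆ (chartAt (EuclideanSpace ℝ (Fin n)) x₀).source) (he : ∀ x ∉ K, e.1 x = 0) :
    ∃ χ : smoothCompactSections n E, ∀ ψ,
      inner ℂ (S.smoothLoc t hμ (S.frameTerm t hμ ht e e' ψ)) (S.smoothLoc t hμ φ) =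
        inner ℂ (S.smoothLoc t hμ ψ) (S.smoothLoc t hμ χ) := by
  have := hμ.isLocallyFiniteMeasure
  obtain ⟨w, hw, hwf⟩ := S.exists_inner_velocity_eq_integral t hμ ht φ hK hKs he
  refine ⟨-Complex.I • smulSection w hw e', fun ψ => ?_⟩
  have hi : ∀ f : testFunctions n Q, Integrable (fun x => f.1 x • w x) μ := fun f =>
    (f.2.1.continuous.smul hw.continuous).integrable_of_hasCompactSupport f.2.2.smul_right
  rw [inner_frameTerm_left, hwf, hwf, map_smul, inner_smul_right, S.inner_smoothLoc,
    ← integral_const_mul, ← integral_sub (hi _) ((hi _).const_mul _)]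
  congr 1
  refine integral_congr_ae (ae_of_all _ fun x => ?_)
  change (inner ℂ (e'.1 x) (ψ.1 x) : ℂ).re • w x -
    Complex.I * ((inner ℂ (e'.1 x) (ψ.1 x) : ℂ).im • w x) = inner ℂ (ψ.1 x) (w x • e'.1 x)
  rw [inner_smul_right, ← inner_conj_symm (ψ.1 x), Complex.real_smul, Complex.real_smul]
  conv_rhs => rw [← Complex.re_add_im (inner ℂ (e'.1 x) (ψ.1 x) : ℂ)]
  rw [map_add, map_mul, Complex.conj_ofReal, Complex.conj_ofReal, Complex.conj_I]
  ring

include ht in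
/-- There is an operator on the smooth sections, with a formal adjoint, whose commutators with the
multiplication operators are the velocities. -/
theorem exists_commutator_eq_velocity :
    ∃ T T' : smoothCompactSections n E →ₗ[ℂ] smoothCompactSections n E,
      (∀ ψ φ, inner ℂ (S.smoothLoc t hμ (T ψ)) (S.smoothLoc t hμ φ) =
        inner ℂ (S.smoothLoc t hμ ψ) (S.smoothLoc t hμ (T' φ))) ∧
      ∀ (a : 𝒜) ψ, T (mulSmooth h𝒜 a ψ) =
        Complex.I • S.velocity t hμ a ψ + mulSmooth h𝒜 a (T ψ) := by
  obtain ⟨ι, e, e', K, c, hK, hKs, hKf, he, he', hsum⟩ :=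
    exists_locallyFinite_dual_frames (n := n) hE
  have hfin : ∀ ψ : smoothCompactSections n E, ∃ (s : Finset ι) (L : Set Q), IsClosed L ∧
      (∀ x ∉ L, ψ.1 x = 0) ∧ ∀ i ∉ s, Disjoint (K i) L := fun ψ => by
    obtain ⟨-, L, hL, hψL⟩ := ψ.2
    refine ⟨(hKf.finite_nonempty_inter_compact hL).toFinset, L, hL.isClosed, hψL, fun i hi => ?_⟩
    rw [Finite.mem_toFinset, mem_ofPred_eq, not_nonempty_iff_eq_empty] at hi
    exact disjoint_iff_inter_eq_empty.2 hi
  have hterm : ∀ i (ψ : smoothCompactSections n E) (L : Set Q), (∀ x ∉ L, ψ.1 x = 0) →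
      Disjoint (K i) L → S.frameTerm t hμ ht (e i) (e' i) ψ = 0 := fun i ψ L hψ hd => by
    refine S.frameTerm_eq_zero t hμ ht fun x => ?_
    by_cases hx : x ∈ K i
    · rw [hψ x (disjoint_left.1 hd hx), inner_zero_right]
    · rw [he' i x hx, inner_zero_left]
  obtain ⟨T, hT⟩ := LinearMap.exists_eq_sum_of_finite
    (fun i => S.frameTerm t hμ ht (e i) (e' i)) fun ψ => by
      obtain ⟨s, L, -, hψ, hd⟩ := hfin ψ
      refine s.finite_toSet.subset fun i hi => ?_
      by_contra h
      exact hi (hterm i ψ L hψ (hd i h))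
  obtain ⟨T', hT'⟩ := LinearMap.exists_formal_adjoint (S.smoothLoc_injective t hμ) (T := T)
    fun φ => by
      classical
      choose χ hχ using fun i => S.exists_adjoint_frameTerm t hμ ht (e' i) φ (hK i) (hKs i) (he i)
      obtain ⟨s, L, hL, hφ, hd⟩ := hfin φ
      refine ⟨∑ i ∈ s, χ i, fun ψ => ?_⟩
      obtain ⟨s', L', -, hψ, hd'⟩ := hfin ψ
      rw [hT ψ (s ∪ s') fun i hi => hterm i ψ L' hψ (hd' i fun h => hi (Finset.mem_union_right _ h)),
        map_sum, sum_inner, map_sum, inner_sum]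
      refine (Finset.sum_subset Finset.subset_union_left fun i _ hi => ?_).symm.trans
        (Finset.sum_congr rfl fun i _ => hχ i ψ)
      exact S.inner_frameTerm_eq_zero t hμ ht hL (he i) hφ (hd i hi) ψ
  refine ⟨T, T', hT', fun a ψ => ?_⟩
  obtain ⟨s, L, -, hψ, hd⟩ := hfin ψ
  have hψa : ∀ x ∉ L, (mulSmooth h𝒜 a ψ).1 x = 0 := fun x hx => by
    change (a.1 x : ℂ) • ψ.1 x = 0
    rw [hψ x hx, smul_zero]
  let θ : ι → smoothCompactSections n E := fun i =>
    ⟨_, smoothSection_smul_mem (e i) (contMDiff_inner hE (e' i) ψ)⟩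
  have hθ : ∑ i ∈ s, θ i = ψ := by
    ext x
    rw [Submodule.coe_sum, Finset.sum_apply]
    by_cases hx : x ∈ L
    · exact hsum ψ.1 s x fun i hi hxi => disjoint_left.1 (hd i hi) hxi hx
    · refine (Finset.sum_eq_zero fun i _ => ?_).trans (hψ x hx).symm
      change (inner ℂ ((e' i).1 x) (ψ.1 x) : ℂ) • (e i).1 x = 0
      rw [hψ x hx, inner_zero_right, zero_smul]
  rw [hT _ s fun i hi => hterm i _ L hψa (hd i hi), hT ψ s fun i hi => hterm i ψ L hψ (hd i hi)]
  conv_rhs => rw [← hθ]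
  rw [map_sum, map_sum, Finset.smul_sum, hθ, ← Finset.sum_add_distrib]
  exact Finset.sum_congr rfl fun i _ => S.frameTerm_mulSmooth t hμ ht (e i) (e' i) ψ a fun x => rfl

include ht in
theorem exists_symmetric_commutator_eq_velocity :
    ∃ h : smoothCompactSections n E →ₗ[ℂ] smoothCompactSections n E,
      (∀ ψ φ, inner ℂ (S.smoothLoc t hμ (h ψ)) (S.smoothLoc t hμ φ) =
        inner ℂ (S.smoothLoc t hμ ψ) (S.smoothLoc t hμ (h φ))) ∧
      ∀ (a : 𝒜) ψ, S.velocity t hμ a ψ =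
        Complex.I • (mulSmooth h𝒜 a (h ψ) - h (mulSmooth h𝒜 a ψ)) := by
  obtain ⟨T, T', hT, hTa⟩ := S.exists_commutator_eq_velocity t hμ ht
  have hT2 : ∀ ψ φ, inner ℂ (S.smoothLoc t hμ (T' ψ)) (S.smoothLoc t hμ φ) =
      inner ℂ (S.smoothLoc t hμ ψ) (S.smoothLoc t hμ (T φ)) := fun ψ φ => by
    rw [← inner_conj_symm, ← hT, inner_conj_symm]
  have hTa' : ∀ (a : 𝒜) ψ, T' (mulSmooth h𝒜 a ψ) =
      Complex.I • S.velocity t hμ a ψ + mulSmooth h𝒜 a (T' ψ) := fun a φ =>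
    S.smooth_ext_inner t hμ fun ψ => by
      have h1 := congrArg (fun σ => inner ℂ (S.smoothLoc t hμ σ) (S.smoothLoc t hμ φ)) (hTa a ψ)
      simp only [map_add, map_smul, inner_add_left, inner_smul_left, Complex.conj_I] at h1
      rw [hT, S.inner_velocity_left, S.inner_mulSmooth_left, S.inner_mulSmooth_left, hT] at h1
      rw [map_add, map_smul, inner_add_right, inner_smul_right, h1]
      ring
  refine ⟨(2⁻¹ : ℂ) • (T + T'), fun ψ φ => ?_, fun a ψ => ?_⟩
  · simp only [LinearMap.smul_apply, LinearMap.add_apply, map_smul, map_add, inner_smul_left,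
      inner_smul_right, inner_add_left, inner_add_right, hT, hT2, map_inv₀, map_ofNat]
    ring
  · simp only [LinearMap.smul_apply, LinearMap.add_apply, hTa, hTa', map_smul, map_add]
    generalize mulSmooth h𝒜 a (T ψ) = u
    generalize mulSmooth h𝒜 a (T' ψ) = v
    have hI : ∀ z : smoothCompactSections n E, Complex.I • Complex.I • z = -z := fun z => by
      rw [smul_smul, Complex.I_mul_I, neg_one_smul]
    have h1 : (2⁻¹ : ℂ) • (u + v) - (2⁻¹ : ℂ) • (Complex.I • S.velocity t hμ a ψ + u +
        (Complex.I • S.velocity t hμ a ψ + v)) = -(Complex.I • S.velocity t hμ a ψ) := by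
      module
    rw [h1, smul_neg, hI, neg_neg]

end ScalarQM

end Hamiltonian

theorem mainTheorem4 {n : ℕ} {Q : Type*} [TopologicalSpace Q] [T2Space Q]
    [SecondCountableTopology Q] [ChartedSpace (EuclideanSpace ℝ (Fin n)) Q]
    [IsManifold (𝓡 n) ∞ Q] [MeasurableSpace Q] [BorelSpace Q]
    {E : Q → Type*} [∀ x, NormedAddCommGroup (E x)] [∀ x, InnerProductSpace ℂ (E x)]
    [TopologicalSpace (TotalSpace ℂ E)] [FiberBundle ℂ E] [VectorBundle ℂ ℂ E]
    [VectorBundle ℝ ℂ E] [ContMDiffVectorBundle ∞ ℂ E (𝓡 n)]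
    (hE : IsSmoothHermitian n E) (μ : Measure Q) (hμ : IsSmoothDensity n μ)
    (𝒜 : NonUnitalSubalgebra ℝ (Q → ℝ)) (h𝒜 : 𝒜 ≤ smoothZeroAtInfty n Q)
    (h𝒜c : ∀ f ∈ smoothZeroAtInfty n Q, HasCompactSupport f → f ∈ 𝒜)
    {H : Type*} [NormedAddCommGroup H] [InnerProductSpace ℂ H] [CompleteSpace H]
    (S : ScalarQM hE μ 𝒜 h𝒜 H) :
    (∀ t : ℝ,
      strongClosure (range (S.rep t)) =
        {T | IsSelfAdjoint T ∧ T ∈ centralizer (range (S.rep t))} ∧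
      strongClosure {A | A ∈ range (S.rep t) ∧ A.IsPositive} =
        {T | T.IsPositive ∧ T ∈ centralizer (range (S.rep t))}) ∧
    ∃ Ham : ℝ → (H →ₗ.[ℂ] H), ∀ t : ℝ,
      ((Ham t).domain : Set H) = S.smoothVectors t ∧
      Dense ((Ham t).domain : Set H) ∧
      (Ham t).IsFormalAdjoint (Ham t) ∧
      ∀ (a : 𝒜) (ψ : (Ham t).domain), ∃ h : S.rep t a ψ ∈ (Ham t).domain,
        HasDerivAt (fun τ => S.rep τ a (ψ : H))
          (Complex.I • (S.rep t a (Ham t ψ) - Ham t ⟨S.rep t a ψ, h⟩)) t := by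
  have ht : testFunctions n Q ≤ 𝒜 := fun f hf =>
    h𝒜c f (testFunctions_le_smoothZeroAtInfty hf) hf.2
  refine ⟨fun t => ⟨S.strongClosure_range_rep t hμ ht, S.strongClosure_positive_rep t hμ ht⟩, ?_⟩
  choose h hsymm hcomm using fun t => S.exists_symmetric_commutator_eq_velocity t hμ ht
  let J := fun t => LinearEquiv.ofInjective (S.smoothLoc t hμ) (S.smoothLoc_injective t hμ)
  refine ⟨fun t => ⟨LinearMap.range (S.smoothLoc t hμ),
    S.smoothLoc t hμ ∘ₗ h t ∘ₗ (J t).symm.toLinearMap⟩, fun t =>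
    ⟨S.coe_range_smoothLoc t hμ, S.dense_range_smoothLoc t hμ, ?_, ?_⟩⟩
  · rintro ⟨_, σ, rfl⟩ ⟨_, τ, rfl⟩
    have hJ : ∀ σ, (J t).symm ⟨S.smoothLoc t hμ σ, σ, rfl⟩ = σ := fun σ =>
      (J t).symm_apply_apply σ
    change inner ℂ (S.smoothLoc t hμ (h t ((J t).symm _))) (S.smoothLoc t hμ τ) =
      inner ℂ (S.smoothLoc t hμ σ) (S.smoothLoc t hμ (h t ((J t).symm _)))
    rw [hJ, hJ]
    exact hsymm t σ τ
  · rintro a ⟨_, σ, rfl⟩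
    have hJ : ∀ ψ (hψ : ψ ∈ LinearMap.range (S.smoothLoc t hμ)) σ, S.smoothLoc t hμ σ = ψ →
        (J t).symm ⟨ψ, hψ⟩ = σ := by
      rintro _ _ σ rfl
      exact (J t).symm_apply_apply σ
    refine ⟨⟨ScalarQM.mulSmooth h𝒜 a σ, (S.rep_smoothLoc t hμ a σ).symm⟩, ?_⟩
    have hσ : S.smoothLoc t hμ σ ∈ LinearMap.range (S.smoothLoc t hμ) :=
      LinearMap.mem_range_self _ σ
    have haσ : S.rep t a (S.smoothLoc t hμ σ) ∈ LinearMap.range (S.smoothLoc t hμ) :=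
      LinearMap.mem_range.2 ⟨ScalarQM.mulSmooth h𝒜 a σ, (S.rep_smoothLoc t hμ a σ).symm⟩
    have key : HasDerivAt (fun τ => S.rep τ a (S.smoothLoc t hμ σ))
        (Complex.I • (S.rep t a (S.smoothLoc t hμ (h t ((J t).symm ⟨_, hσ⟩))) -
          S.smoothLoc t hμ (h t ((J t).symm ⟨_, haσ⟩)))) t := by
      rw [hJ _ hσ σ rfl, hJ _ haσ _ (S.rep_smoothLoc t hμ a σ).symm, S.rep_smoothLoc, ← map_sub,
        ← map_smul, ← hcomm]
      exact S.hasDerivAt_velocity t hμ a σ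
    exact key
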